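/- Let $\alpha,\beta\in\mathbb C$ satisfy either $\operatorname{Re}\beta>-1$ ($\alpha$ arbitrary), or $\operatorname{Re}\beta=-1$ and $\operatorname{Re}\alpha<-1$. With principal values of the logarithm and of the powers, the integral $$I(\alpha,\beta)=\int_{-\pi/2}^{\pi/2}\left(1+e^{-2ix}\right)^{\beta}\ln^{\alpha}\left(1+e^{-2ix}\right)dx$$ converges absolutely, and $$I(\alpha,\beta)=-\frac{\pi}{\Gamma(-\alpha)}\,\zeta(\alpha+1,\beta+1).$$ Here, for fixed $a$, the Hurwitz zeta function $s\mapsto\zeta(s,a)$ is the analytic continuation to $\mathbb C\setminus\{1\}$ of $\sum_{n\ge 0}(n+a)^{-s}$, $\operatorname{Re}s>1$ (principal powers; a term with $n+a=0$ is omitted, so $\zeta(s,0)=\zeta(s)$), and $1/\Gamma(-\alpha)$ is $0$ for $\alpha=0,1,2,\dots$. For $\alpha=0$ (which requires $\operatorname{Re}\beta>-1$) the right-hand side is understood as its limit as $\alpha\to0$, which exists and equals $\pi$; thus $I(0,\beta)=\pi$. In particular ($\beta=0$), for every $\alpha\in\mathbb C$ the integral below converges absolutely and $$\int_{-\pi/2}^{\pi/2}\ln^{\alpha-1}\left(1+e^{-2ix}\right)dx=-\frac{\pi\,\zeta(\alpha)}{\Gamma(1-\alpha)},$$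 where $\zeta$ is the Riemann zeta function and for $\alpha=1$ the right-hand side is understood as its limit as $\alpha\to1$, which is $\pi$. -/

import Mathlib

/-- `Z` is the Hurwitz zeta function `s ↦ ζ(s, a)`: it is holomorphic on `ℂ ∖ {1}` and is given for
`Re s > 1` by the (convergent) Dirichlet series `∑_{n ≥ 0} (n + a)^(-s)`, with principal powers.
A term with `n + a = 0` is omitted, as usual: it is `1 / 0 ^ s = 1 / 0 = 0` here,
so that `ζ(s, 0)` is `ζ(s)`. -/
def IsHurwitzZeta (a : ℂ) (Z : ℂ → ℂ) : Prop :=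
  DifferentiableOn ℂ Z {1}ᶜ ∧
    ∀ s : ℂ, 1 < s.re → HasSum (fun n : ℕ => 1 / ((n : ℂ) + a) ^ s) (Z s)

open Classical in
/-- The Hurwitz zeta function `ζ(s, a)` of complex arguments, `s ≠ 1`: the analytic continuation
in `s` of the Dirichlet series `∑_{n ≥ 0} (n + a)^(-s)` to `ℂ ∖ {1}`. -/
noncomputable def hurwitzZetaC (s a : ℂ) : ℂ :=
  if h : ∃ Z : ℂ → ℂ, IsHurwitzZeta a Z then h.choose s else 0

/-- The continuation is unique, so `hurwitzZetaC` is well defined away from `s = 1`. -/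
theorem IsHurwitzZeta.hurwitzZetaC_eq {a : ℂ} {Z : ℂ → ℂ} (hZ : IsHurwitzZeta a Z)
    {s : ℂ} (hs : s ≠ 1) : hurwitzZetaC s a = Z s := by
  have hex : ∃ Z : ℂ → ℂ, IsHurwitzZeta a Z := ⟨Z, hZ⟩
  have hW := hex.choose_spec
  have hdef : hurwitzZetaC s a = hex.choose s := by
    unfold hurwitzZetaC
    rw [dif_pos hex]
  rw [hdef]
  have hopen : IsOpen ({1}ᶜ : Set ℂ) := isOpen_compl_singleton
  have hconn : IsPreconnected ({1}ᶜ : Set ℂ) :=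
    (isConnected_compl_singleton_of_one_lt_rank (by simp) 1).isPreconnected
  have h2 : (2 : ℂ) ∈ ({1}ᶜ : Set ℂ) := by simp
  have hnear : hex.choose =ᶠ[nhds 2] Z := by
    have : {z : ℂ | 1 < z.re} ∈ nhds (2 : ℂ) :=
      (isOpen_lt continuous_const Complex.continuous_re).mem_nhds (by simp)
    filter_upwards [this] with z hz
    exact (hW.2 z hz).unique (hZ.2 z hz)
  exact (hW.1.analyticOnNhd hopen).eqOn_of_preconnected_of_eventuallyEq
    (hZ.1.analyticOnNhd hopen) hconn h2 hnear hs

/-- The integrand `(1 + e^{-2ix})^β ln^α(1 + e^{-2ix})`, with principal logarithm and powers. On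
`-π/2 < x < π/2` one has `ln(1 + e^{-2ix}) = ln(2 cos x) - ix`, which stays off `(-∞, 0]`. -/
noncomputable def hurwitzIntegrand (α β : ℂ) (x : ℝ) : ℂ :=
  (1 + Complex.exp (-2 * Complex.I * x)) ^ β *
    (Complex.log (1 + Complex.exp (-2 * Complex.I * x))) ^ α

open MeasureTheory Filter Topology

/-! The integral runs over the circle `|z - 1| = 1`, with integrand `z ^ β * log z ^ α` and `z = 1 +
e^ζ`, `ζ = iθ`, `θ = -2x`. Writing `log z ^ α` as `e^(αζ) (log (1 + e^ζ) / e^ζ) ^ α` makes it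
holomorphic for `Re ζ < 0`, because `log (1 + u) / u` has positive real part when `Re u > -1`
(`re_log_one_add_div_pos`). The two edges `Im ζ = ±π` of the strip then differ only by the factor
`e^(±iπα)`.

Cauchy's theorem on a rectangle (`arcIntegral_eq_add`) turns the difference of two arc integrals
into `2 sin(πα)` times an edge integral. The substitution `1 - e^ρ = e^(-t)` makes the latter a
piece of the Mellin integral of `e^(-(β+1)t) / (1 - e^(-t))`, which equals `Γ(α+1) ζ(α+1, β+1)`. For
`Re α > 0` the small arcs vanish and the reflection formula gives the claim
(`integral_hurwitzIntegrand_eq_mellin`). For `α = 0` all arcs have the same integral `2π`.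

For `Re β > -1` the integral is entire in `α`, so it provides the analytic continuation of the
Hurwitz zeta function itself (`isHurwitzZeta_hurwitzContinuation`), which covers the remaining `α`.
The line `Re β = -1` follows by letting `β + ε → β` and using `ζ(s, a) = a^(-s) + ζ(s, a + 1)`. -/

/-! ### Bounds for principal powers and logarithms. -/

theorem norm_cpow_le_rpow_mul_exp (z s : ℂ) :
    ‖z ^ s‖ ≤ ‖z‖ ^ s.re * Real.exp (Real.pi * |s.im|) := by
  refine (Complex.norm_cpow_le z s).trans ?_
  rw [div_eq_mul_inv, ← Real.exp_neg]
  gcongr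
  calc -(z.arg * s.im) ≤ |z.arg * s.im| := neg_le_abs _
    _ = |z.arg| * |s.im| := abs_mul _ _
    _ ≤ Real.pi * |s.im| := by gcongr; exact Complex.abs_arg_le_pi z

/-- If `|log z| < 1/2`, then `|e^(log z) - 1| ≤ 2 |log z| < 1`. This keeps negative powers of `log
z` bounded on the circle. -/
theorem half_le_norm_log {z : ℂ} (hz : z ≠ 0) (h : ‖z - 1‖ = 1) : 1 / 2 ≤ ‖Complex.log z‖ := by
  by_contra! hlt
  have := Complex.norm_exp_sub_one_le (x := Complex.log z) (by linarith)
  rw [Complex.exp_log hz, h] at this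
  linarith

theorem norm_complex_log_le (z : ℂ) : ‖Complex.log z‖ ≤ |Real.log ‖z‖| + Real.pi := by
  refine (Complex.norm_le_abs_re_add_abs_im _).trans ?_
  rw [Complex.log_re, Complex.log_im]
  gcongr
  exact Complex.abs_arg_le_pi z

theorem exists_one_add_norm_log_rpow_le {B δ : ℝ} (hB : 0 < B) (hδ : 0 < δ) :
    ∃ C : ℝ, 0 < C ∧ ∀ z : ℂ, z ≠ 0 → ‖z‖ ≤ 2 →
      (1 + ‖Complex.log z‖) ^ B ≤ C * ‖z‖ ^ (-δ) := by
  set η := δ / B with hη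
  have hη0 : 0 < η := div_pos hδ hB
  -- The 6 collects the summand 1, the 1 in the bound for `|log ‖z‖|`, and `π ≤ 4`; the factor `2 ^
  -- η` absorbs constants into `‖z‖ ^ (-η)`, as `‖z‖ ≤ 2`.
  refine ⟨(6 * 2 ^ η + 1 / η) ^ B, by positivity, fun z hz hz2 => ?_⟩
  have ht : 0 < ‖z‖ := norm_pos_iff.mpr hz
  have h1 : 1 ≤ 2 ^ η * ‖z‖ ^ (-η) := by
    rw [Real.rpow_neg ht.le, ← div_eq_mul_inv, one_le_div (by positivity)]
    gcongr
  have hnl : -Real.log ‖z‖ ≤ ‖z‖ ^ (-η) / η := by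
    have := Real.log_le_rpow_div (x := ‖z‖⁻¹) (by positivity) hη0
    rwa [Real.log_inv, Real.inv_rpow ht.le, ← Real.rpow_neg ht.le] at this
  have hl : Real.log ‖z‖ ≤ 1 := by
    have := Real.log_le_sub_one_of_pos ht
    linarith
  have habs : |Real.log ‖z‖| ≤ 1 + ‖z‖ ^ (-η) / η := by
    have : 0 < ‖z‖ ^ (-η) / η := by positivity
    rw [abs_le]
    constructor <;> linarith
  have hkey : 1 + ‖Complex.log z‖ ≤ (6 * 2 ^ η + 1 / η) * ‖z‖ ^ (-η) := by
    have := norm_complex_log_le z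
    have hpi := Real.pi_le_four
    calc 1 + ‖Complex.log z‖ ≤ 6 * 1 + ‖z‖ ^ (-η) / η := by linarith
      _ ≤ 6 * (2 ^ η * ‖z‖ ^ (-η)) + ‖z‖ ^ (-η) / η := by gcongr
      _ = _ := by ring
  calc (1 + ‖Complex.log z‖) ^ B ≤ ((6 * 2 ^ η + 1 / η) * ‖z‖ ^ (-η)) ^ B := by gcongr
    _ = _ := by
      rw [Real.mul_rpow (by positivity) (by positivity), ← Real.rpow_mul ht.le]
      congr 2
      rw [hη]; field_simp

/-- Both `W` and `W⁻¹` are at most `2 (1 + W)`, so one bound serves exponents of either sign. -/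
theorem rpow_le_two_mul_one_add_rpow {W p A : ℝ} (hW : 1 / 2 ≤ W) (hp : |p| ≤ A) :
    W ^ p ≤ (2 * (1 + W)) ^ A := by
  have hpA := abs_le.mp hp
  have hA : 0 ≤ A := (abs_nonneg p).trans hp
  have hW0 : 0 < W := by linarith
  rcases le_total 0 p with h | h
  · calc W ^ p ≤ (2 * (1 + W)) ^ p := by gcongr; linarith
      _ ≤ _ := Real.rpow_le_rpow_of_exponent_le (by linarith) hpA.2
  · calc W ^ p = (W⁻¹) ^ (-p) := by rw [Real.inv_rpow hW0.le, Real.rpow_neg hW0.le, inv_inv]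
      _ ≤ (2 * (1 + W)) ^ (-p) := by
        gcongr
        · linarith
        · calc W⁻¹ ≤ (1 / 2)⁻¹ := by gcongr
            _ ≤ 2 * (1 + W) := by norm_num; linarith
      _ ≤ _ := Real.rpow_le_rpow_of_exponent_le (by linarith) (by linarith)

theorem exists_norm_log_rpow_le {A δ : ℝ} (hδ : 0 < δ) :
    ∃ C : ℝ, 0 < C ∧ ∀ z : ℂ, z ≠ 0 → ‖z - 1‖ = 1 → ∀ p : ℝ, |p| ≤ A →
      ‖Complex.log z‖ ^ p ≤ C * ‖z‖ ^ (-δ) := by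
  obtain ⟨C, hC, h⟩ := exists_one_add_norm_log_rpow_le (B := |A| + 1) (by positivity) hδ
  refine ⟨2 ^ (|A| + 1) * C, by positivity, fun z hz hz1 p hp => ?_⟩
  have hz2 : ‖z‖ ≤ 2 := by
    calc ‖z‖ = ‖(z - 1) + 1‖ := by simp
      _ ≤ ‖z - 1‖ + ‖(1 : ℂ)‖ := norm_add_le _ _
      _ = 2 := by rw [hz1]; norm_num
  have hA : |p| ≤ |A| + 1 := hp.trans ((le_abs_self A).trans (by linarith))
  refine (rpow_le_two_mul_one_add_rpow (half_le_norm_log hz hz1) hA).trans ?_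
  rw [Real.mul_rpow (by norm_num) (by positivity), mul_assoc]
  gcongr
  exact h z hz hz2

/-! ### The size of `1 + e^(-2ix)` and absolute convergence. -/

theorem norm_one_add_exp_sub_one (x : ℝ) :
    ‖1 + Complex.exp (-2 * Complex.I * x) - 1‖ = 1 := by
  rw [add_sub_cancel_left, Complex.norm_exp]
  simp

theorem one_add_exp_eq (x : ℝ) : 1 + Complex.exp (-2 * Complex.I * x) =
    (2 * Real.cos x : ℝ) * Complex.exp (-(x * Complex.I)) := by
  push_cast
  rw [Complex.two_cos, add_mul, ← Complex.exp_add, ← Complex.exp_add]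
  ring_nf
  simp [add_comm]

theorem norm_one_add_exp {x : ℝ} (hx : |x| ≤ Real.pi / 2) :
    ‖1 + Complex.exp (-2 * Complex.I * x)‖ = 2 * Real.cos x := by
  have hc : 0 ≤ Real.cos x := Real.cos_nonneg_of_mem_Icc (abs_le.mp hx)
  rw [one_add_exp_eq, norm_mul, Complex.norm_real, Complex.norm_exp, Real.norm_eq_abs,
    abs_of_nonneg (by positivity)]
  simp

/-- Jordan's inequality, with `2/π ≥ 1/2`. -/
theorem two_mul_sub_abs_le_cos {x : ℝ} (hx : |x| ≤ Real.pi / 2) :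
    Real.pi / 2 - |x| ≤ 2 * Real.cos x := by
  have := Real.one_sub_mul_le_cos (abs_nonneg x) hx
  rw [Real.cos_abs] at this
  have hpi := Real.pi_pos
  have hpi4 := Real.pi_le_four
  have e : 1 - 2 / Real.pi * |x| = (2 / Real.pi) * (Real.pi / 2 - |x|) := by field_simp
  have h2 : 1 / 2 ≤ 2 / Real.pi := by rw [div_le_div_iff₀ (by norm_num) hpi]; linarith
  have : 1 / 2 * (Real.pi / 2 - |x|) ≤ 2 / Real.pi * (Real.pi / 2 - |x|) := by
    gcongr
  linarith

theorem cos_le_sub_abs {x : ℝ} (hx : |x| ≤ Real.pi / 2) :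
    Real.cos x ≤ Real.pi / 2 - |x| := by
  rw [← Real.cos_abs, ← Real.sin_pi_div_two_sub]
  exact Real.sin_le (by linarith)

theorem one_add_exp_ne_zero {x : ℝ} (hx : |x| < Real.pi / 2) :
    1 + Complex.exp (-2 * Complex.I * x) ≠ 0 := by
  rw [← norm_pos_iff, norm_one_add_exp hx.le]
  have := Real.cos_pos_of_mem_Ioo (abs_lt.mp hx)
  positivity

theorem intervalIntegrable_comp_sub_abs {f : ℝ → ℝ} {c : ℝ} (hc : 0 ≤ c)
    (hf : IntervalIntegrable f volume 0 c) :
    IntervalIntegrable (fun x => f (c - |x|)) volume (-c) c := by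
  have h1 : IntervalIntegrable (fun x => f (c - x)) volume 0 c := by
    have := hf.comp_sub_left c
    simpa using this.symm
  have h2 : IntervalIntegrable (fun x => f (c + x)) volume (-c) 0 := by
    have := hf.comp_add_left c
    simpa using this
  refine IntervalIntegrable.trans (b := 0) ?_ ?_
  · refine h2.congr fun x hx => ?_
    rw [Set.uIoc_of_le (by linarith)] at hx
    simp [abs_of_nonpos hx.2]
  · refine h1.congr fun x hx => ?_
    rw [Set.uIoc_of_le hc] at hx
    simp [abs_of_pos hx.1]

theorem intervalIntegrable_inv_mul_log_rpow {p b K : ℝ} (hp : 1 < p) (hb : 0 ≤ b)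
    (hK : Real.log b < K) :
    IntervalIntegrable (fun y => y⁻¹ * (K - Real.log y) ^ (-p)) volume 0 b := by
  rcases hb.eq_or_lt with rfl | hb
  · simp
  rw [intervalIntegrable_iff_integrableOn_Ioc_of_le hb.le]
  -- An antiderivative, set to its limit 0 at `y = 0`, where the default `Real.log 0 = 0` would
  -- break continuity.
  set g : ℝ → ℝ := fun y => if y = 0 then 0 else (K - Real.log y) ^ (-(p - 1)) / (p - 1) with hg
  have hpos : ∀ y, 0 < y → y ≤ b → 0 < K - Real.log y := fun y h0 hy => by
    have := Real.log_le_log h0 hy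
    linarith
  have hder : ∀ y, 0 < y → y ≤ b → HasDerivAt g (y⁻¹ * (K - Real.log y) ^ (-p)) y := by
    intro y h0 hy
    have h1 : HasDerivAt (fun y => K - Real.log y) (-y⁻¹) y := by
      simpa using (Real.hasDerivAt_log h0.ne').const_sub K
    have h2 := (h1.rpow_const (p := -(p - 1)) (Or.inl (hpos y h0 hy).ne')).div_const (p - 1)
    have h3 := h2.congr_of_eventuallyEq (f₁ := g) (by
      filter_upwards [lt_mem_nhds h0] with z hz
      simp [hg, hz.ne'])
    have hp1 : p - 1 ≠ 0 := by linarith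
    have e : -y⁻¹ * -(p - 1) * (K - Real.log y) ^ (-(p - 1) - 1) / (p - 1) =
        y⁻¹ * (K - Real.log y) ^ (-p) := by
      rw [show -(p - 1) - 1 = -p by ring]
      field_simp
    rwa [e] at h3
  apply intervalIntegral.integrableOn_deriv_of_nonneg (g := g)
  · intro y hy
    rcases hy.1.eq_or_lt with rfl | h0
    · have hg0 : g 0 = 0 := by simp [hg]
      rw [ContinuousWithinAt, hg0]
      have hlim : Tendsto (fun y : ℝ => (K - Real.log y) ^ (-(p - 1)) / (p - 1)) (𝓝[>] 0) (𝓝 0) := by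
        have h1 : Tendsto (fun y : ℝ => K - Real.log y) (𝓝[>] 0) atTop := by
          have := tendsto_neg_atBot_atTop.comp Real.tendsto_log_nhdsGT_zero
          simpa [sub_eq_add_neg] using tendsto_atTop_add_const_left _ K this
        simpa using ((tendsto_rpow_neg_atTop (y := p - 1) (by linarith)).comp h1).div_const (p - 1)
      have hle : 𝓝[Set.Icc 0 b] (0 : ℝ) ≤ 𝓝[≥] 0 := nhdsWithin_mono _ Set.Icc_subset_Ici_self
      refine Tendsto.mono_left ?_ hle
      rw [← Set.Ioi_insert, nhdsWithin_insert]
      refine Tendsto.sup ?_ ?_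
      · rw [tendsto_pure_left]
        intro s hs
        rw [hg0]
        exact mem_of_mem_nhds hs
      · refine hlim.congr' ?_
        filter_upwards [self_mem_nhdsWithin] with z hz
        simp [hg, (Set.mem_Ioi.mp hz).ne']
    · exact (hder y h0 hy.2).continuousAt.continuousWithinAt
  · intro y hy
    exact hder y hy.1 hy.2.le
  · intro y hy
    have := hpos y hy.1 hy.2.le
    have := hy.1
    positivity

theorem measurable_hurwitzIntegrand (α β : ℂ) : Measurable (hurwitzIntegrand α β) := by
  unfold hurwitzIntegrand
  fun_prop

theorem ae_abs_lt_pi_div_two : ∀ᵐ x : ℝ ∂volume,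
    x ∈ Set.uIoc (-(Real.pi / 2)) (Real.pi / 2) → |x| < Real.pi / 2 := by
  have : ∀ᵐ x : ℝ ∂volume, x ≠ Real.pi / 2 := by simp [ae_iff, measure_singleton]
  filter_upwards [this] with x hx hm
  rw [Set.uIoc_of_le (by linarith [Real.pi_pos])] at hm
  exact abs_lt.mpr ⟨hm.1, lt_of_le_of_ne hm.2 hx⟩

theorem intervalIntegrable_norm_one_add_exp_rpow {γ : ℝ} (h0 : 0 ≤ γ) (h1 : γ < 1) :
    IntervalIntegrable (fun x : ℝ => ‖1 + Complex.exp (-2 * Complex.I * x)‖ ^ (-γ)) volume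
      (-(Real.pi / 2)) (Real.pi / 2) := by
  have hpi := Real.pi_pos
  have hb := intervalIntegrable_comp_sub_abs (f := fun y => y ^ (-γ)) (c := Real.pi / 2)
    (by positivity) (intervalIntegral.intervalIntegrable_rpow' (by linarith))
  refine hb.mono_fun' (Measurable.aestronglyMeasurable (by fun_prop)) ?_
  rw [EventuallyLE, ae_restrict_iff' measurableSet_uIoc]
  filter_upwards [ae_abs_lt_pi_div_two] with x hx hm
  have hx' := hx hm
  rw [Real.norm_of_nonneg (by positivity), norm_one_add_exp hx'.le]
  exact Real.rpow_le_rpow_of_nonpos (by linarith) (two_mul_sub_abs_le_cos hx'.le) (by linarith)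

/-- The borderline case `Re β = -1`: with `y` the distance to the nearer endpoint, `‖z‖ ≥ y` and
`|log z|` grows like `-log y`, so the model is `y⁻¹ (K - log y) ^ (-p)`. -/
theorem intervalIntegrable_norm_one_add_exp_mul_log {p : ℝ} (hp : 1 < p) :
    IntervalIntegrable (fun x : ℝ => ‖1 + Complex.exp (-2 * Complex.I * x)‖ ^ (-1 : ℝ) *
      ‖Complex.log (1 + Complex.exp (-2 * Complex.I * x))‖ ^ (-p)) volume
      (-(Real.pi / 2)) (Real.pi / 2) := by
  have hpi := Real.pi_pos
  have hlogpi : Real.log (2 * (Real.pi / 2)) < 2 := by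
    rw [mul_div_cancel₀ _ (by norm_num : (2 : ℝ) ≠ 0), Real.log_lt_iff_lt_exp hpi]
    calc Real.pi < 3.15 := Real.pi_lt_d2
      _ < 2.7 * 2.7 := by norm_num
      _ < Real.exp 1 * Real.exp 1 := by
        have := Real.exp_one_gt_d9
        nlinarith
      _ = Real.exp 2 := by rw [← Real.exp_add]; norm_num
  have hK : Real.log (Real.pi / 2) < 2 - Real.log 2 := by
    rw [Real.log_mul (by norm_num) (by positivity)] at hlogpi
    linarith
  have hb := (intervalIntegrable_comp_sub_abs (c := Real.pi / 2) (by positivity)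
    (intervalIntegrable_inv_mul_log_rpow hp (by positivity) hK)).const_mul (5 ^ p)
  refine hb.mono_fun' (Measurable.aestronglyMeasurable (by fun_prop)) ?_
  rw [EventuallyLE, ae_restrict_iff' measurableSet_uIoc]
  filter_upwards [ae_abs_lt_pi_div_two] with x hx hm
  have hx' := hx hm
  have hz := one_add_exp_ne_zero hx'
  have hw := half_le_norm_log hz (norm_one_add_exp_sub_one x)
  rw [Real.norm_of_nonneg (by positivity)]
  set y := Real.pi / 2 - |x| with hy
  have hy0 : 0 < y := by linarith
  have hypi : y ≤ Real.pi / 2 := by have := abs_nonneg x; linarith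
  set W := ‖Complex.log (1 + Complex.exp (-2 * Complex.I * x))‖ with hW
  have hn := norm_one_add_exp hx'.le
  have hlow : -Real.log ‖1 + Complex.exp (-2 * Complex.I * x)‖ ≤ W := by
    have := Complex.abs_re_le_norm (Complex.log (1 + Complex.exp (-2 * Complex.I * x)))
    rw [Complex.log_re] at this
    exact (neg_le_abs _).trans this
  have hlog : Real.log ‖1 + Complex.exp (-2 * Complex.I * x)‖ ≤ Real.log 2 + Real.log y := by
    rw [← Real.log_mul (by norm_num) hy0.ne', hn]
    apply Real.log_le_log
    · have := Real.cos_pos_of_mem_Ioo (abs_lt.mp hx')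
      positivity
    · linarith [cos_le_sub_abs hx'.le]
  have hpos : 0 < 2 - Real.log 2 - Real.log y := by
    have := Real.log_le_log hy0 hypi
    linarith
  -- `5W = W + 4W`, with `W ≥ -log 2 - log y` and `4W ≥ 2`. The added 2 keeps the left side positive
  -- up to `y = π/2`, as `log π < 2`.
  have h5 : (2 - Real.log 2 - Real.log y) / 5 ≤ W := by linarith
  have hA : ‖1 + Complex.exp (-2 * Complex.I * x)‖ ^ (-1 : ℝ) ≤ y⁻¹ := by
    rw [Real.rpow_neg_one, hn]
    exact inv_anti₀ hy0 (two_mul_sub_abs_le_cos hx'.le)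
  have hB : W ^ (-p) ≤ 5 ^ p * (2 - Real.log 2 - Real.log y) ^ (-p) := by
    refine (Real.rpow_le_rpow_of_nonpos (by positivity) h5 (by linarith)).trans (le_of_eq ?_)
    rw [Real.div_rpow hpos.le (by norm_num), Real.rpow_neg (by norm_num : (0 : ℝ) ≤ 5), div_inv_eq_mul,
      mul_comm]
  calc _ ≤ y⁻¹ * (5 ^ p * (2 - Real.log 2 - Real.log y) ^ (-p)) := by gcongr
    _ = _ := by ring

theorem exists_norm_rpow_mul_norm_log_rpow_le {b A : ℝ} (hb : -1 < b) :
    ∃ γ C : ℝ, 0 ≤ γ ∧ γ < 1 ∧ 0 < C ∧ ∀ z : ℂ, z ≠ 0 → ‖z - 1‖ = 1 → ∀ p : ℝ, |p| ≤ A →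
      ‖z‖ ^ b * ‖Complex.log z‖ ^ p ≤ C * ‖z‖ ^ (-γ) := by
  set b' := min b 0 with hb'
  have h1 : -1 < b' := lt_min hb (by norm_num)
  have h0 : b' ≤ 0 := min_le_right _ _
  -- The logarithm may use half of the margin `b' + 1`, leaving `γ = (1 - b') / 2 < 1`.
  set δ := (b' + 1) / 2 with hδ
  obtain ⟨C, hC, h⟩ := exists_norm_log_rpow_le (A := A) (δ := δ) (by linarith)
  refine ⟨δ - b', 2 ^ (b - b') * C, by linarith, by linarith, by positivity,
    fun z hz hz1 p hp => ?_⟩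
  have hn : 0 < ‖z‖ := norm_pos_iff.mpr hz
  have hz2 : ‖z‖ ≤ 2 := by
    calc ‖z‖ = ‖(z - 1) + 1‖ := by simp
      _ ≤ ‖z - 1‖ + ‖(1 : ℂ)‖ := norm_add_le _ _
      _ = 2 := by rw [hz1]; norm_num
  have hbb : 0 ≤ b - b' := sub_nonneg.mpr (min_le_left _ _)
  have e1 : ‖z‖ ^ b ≤ 2 ^ (b - b') * ‖z‖ ^ b' := by
    calc ‖z‖ ^ b = ‖z‖ ^ (b - b') * ‖z‖ ^ b' := by rw [← Real.rpow_add hn]; ring_nf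
      _ ≤ _ := by gcongr
  calc _ ≤ (2 ^ (b - b') * ‖z‖ ^ b') * (C * ‖z‖ ^ (-δ)) := by
        gcongr
        exact h z hz hz1 p hp
    _ = 2 ^ (b - b') * C * (‖z‖ ^ b' * ‖z‖ ^ (-δ)) := by ring
    _ = _ := by rw [← Real.rpow_add hn]; ring_nf

theorem intervalIntegrable_norm_rpow_mul_norm_log_rpow {a b : ℝ}
    (h : -1 < b ∨ (b = -1 ∧ a < -1)) :
    IntervalIntegrable (fun x : ℝ => ‖1 + Complex.exp (-2 * Complex.I * x)‖ ^ b *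
      ‖Complex.log (1 + Complex.exp (-2 * Complex.I * x))‖ ^ a) volume
      (-(Real.pi / 2)) (Real.pi / 2) := by
  rcases h with hb | ⟨rfl, ha⟩
  · obtain ⟨γ, C, h0, h1, hC, hle⟩ := exists_norm_rpow_mul_norm_log_rpow_le (A := |a|) hb
    refine ((intervalIntegrable_norm_one_add_exp_rpow h0 h1).const_mul C).mono_fun'
      (Measurable.aestronglyMeasurable (by fun_prop)) ?_
    rw [EventuallyLE, ae_restrict_iff' measurableSet_uIoc]
    filter_upwards [ae_abs_lt_pi_div_two] with x hx hm
    rw [Real.norm_of_nonneg (by positivity)]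
    exact hle _ (one_add_exp_ne_zero (hx hm)) (norm_one_add_exp_sub_one x) a le_rfl
  · simpa using intervalIntegrable_norm_one_add_exp_mul_log (p := -a) (by linarith)

theorem norm_hurwitzIntegrand_le (α β : ℂ) (x : ℝ) :
    ‖hurwitzIntegrand α β x‖ ≤ Real.exp (Real.pi * |β.im|) * Real.exp (Real.pi * |α.im|) *
      (‖1 + Complex.exp (-2 * Complex.I * x)‖ ^ β.re *
        ‖Complex.log (1 + Complex.exp (-2 * Complex.I * x))‖ ^ α.re) := by
  rw [hurwitzIntegrand, norm_mul]
  refine (mul_le_mul (norm_cpow_le_rpow_mul_exp _ _) (norm_cpow_le_rpow_mul_exp _ _)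
    (norm_nonneg _) (by positivity)).trans (le_of_eq ?_)
  ring

theorem intervalIntegrable_hurwitzIntegrand {α β : ℂ}
    (h : -1 < β.re ∨ (β.re = -1 ∧ α.re < -1)) :
    IntervalIntegrable (hurwitzIntegrand α β) volume (-(Real.pi / 2)) (Real.pi / 2) := by
  exact ((intervalIntegrable_norm_rpow_mul_norm_log_rpow h).const_mul _).mono_fun'
    (measurable_hurwitzIntegrand α β).aestronglyMeasurable
    (ae_of_all _ (norm_hurwitzIntegrand_le α β))

/-! ### Dependence of the integral on the parameters. -/

/-- Raising `β` by `ε ≤ 1` costs at most a factor `‖z‖ ^ ε ≤ 2`, so dominated convergence reaches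
the line `Re β = -1` too. -/
theorem tendsto_integral_hurwitzIntegrand_add {α β : ℂ}
    (h : -1 < β.re ∨ (β.re = -1 ∧ α.re < -1)) :
    Tendsto (fun ε : ℝ => ∫ x in (-(Real.pi / 2))..(Real.pi / 2), hurwitzIntegrand α (β + ε) x)
      (𝓝[>] 0) (𝓝 (∫ x in (-(Real.pi / 2))..(Real.pi / 2), hurwitzIntegrand α β x)) := by
  refine intervalIntegral.tendsto_integral_filter_of_dominated_convergence _
    (Eventually.of_forall fun ε => (measurable_hurwitzIntegrand α _).aestronglyMeasurable) ?_
    ((intervalIntegrable_norm_rpow_mul_norm_log_rpow h).const_mul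
      (2 * (Real.exp (Real.pi * |β.im|) * Real.exp (Real.pi * |α.im|)))) ?_
  · filter_upwards [Ioo_mem_nhdsGT (zero_lt_one (α := ℝ))] with ε hε
    filter_upwards [ae_abs_lt_pi_div_two] with x hx hm
    have hz := one_add_exp_ne_zero (hx hm)
    have hn := norm_pos_iff.mpr hz
    refine (norm_hurwitzIntegrand_le α _ x).trans ?_
    simp only [Complex.add_im, Complex.ofReal_im, add_zero, Complex.add_re, Complex.ofReal_re]
    rw [mul_assoc 2, mul_left_comm 2]
    refine mul_le_mul_of_nonneg_left ?_ (by positivity)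
    rw [← mul_assoc]
    refine mul_le_mul_of_nonneg_right ?_ (by positivity)
    rw [add_comm β.re ε, Real.rpow_add hn]
    refine mul_le_mul_of_nonneg_right ?_ (by positivity)
    have hn2 : ‖1 + Complex.exp (-2 * Complex.I * x)‖ ≤ 2 := by
      rw [norm_one_add_exp (hx hm).le]
      linarith [Real.cos_le_one x]
    calc _ ≤ (2 : ℝ) ^ ε := Real.rpow_le_rpow hn.le hn2 hε.1.le
      _ ≤ 2 ^ (1 : ℝ) := Real.rpow_le_rpow_of_exponent_le (by norm_num) hε.2.le
      _ = 2 := by simp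
  · filter_upwards [ae_abs_lt_pi_div_two] with x hx hm
    have hz := one_add_exp_ne_zero (hx hm)
    unfold hurwitzIntegrand
    refine Tendsto.mul_const _ ?_
    have hc : ContinuousAt (fun ε : ℝ => (1 + Complex.exp (-2 * Complex.I * x)) ^ (β + ε)) 0 := by
      refine ContinuousAt.const_cpow (by fun_prop) (Or.inl hz)
    simpa using hc.tendsto.mono_left nhdsWithin_le_nhds

theorem differentiable_integral_hurwitzIntegrand {β : ℂ} (hβ : -1 < β.re) :
    Differentiable ℂ (fun α : ℂ =>
      ∫ x in (-(Real.pi / 2))..(Real.pi / 2), hurwitzIntegrand α β x) := by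
  intro α₀
  obtain ⟨γ, C, h0, h1, hC, hle⟩ :=
    -- One unit for the ball around `α₀`, one for the shifts `α ± 1` caused by `log (log z)`.
    exists_norm_rpow_mul_norm_log_rpow_le (A := |α₀.re| + 2) hβ
  set M := Real.exp (Real.pi * |β.im|) * Real.exp (Real.pi * (|α₀.im| + 1)) with hM
  refine (intervalIntegral.hasDerivAt_integral_of_dominated_loc_of_deriv_le
    (F' := fun α x => hurwitzIntegrand α β x *
      Complex.log (Complex.log (1 + Complex.exp (-2 * Complex.I * x))))
    (bound := fun x => M * (10 * C) * ‖1 + Complex.exp (-2 * Complex.I * x)‖ ^ (-γ))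
    (Metric.ball_mem_nhds α₀ one_pos)
    (Eventually.of_forall fun α => (measurable_hurwitzIntegrand α _).aestronglyMeasurable)
    (intervalIntegrable_hurwitzIntegrand (Or.inl hβ))
    ?_ ?_ ((intervalIntegrable_norm_one_add_exp_rpow h0 h1).const_mul _) ?_).2.differentiableAt
  · refine Measurable.aestronglyMeasurable ((measurable_hurwitzIntegrand _ _).mul ?_)
    fun_prop
  · filter_upwards [ae_abs_lt_pi_div_two] with x hx hm α hα
    have hz := one_add_exp_ne_zero (hx hm)
    set z := 1 + Complex.exp (-2 * Complex.I * x) with hzdef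
    have hz1 : ‖z - 1‖ = 1 := norm_one_add_exp_sub_one x
    have hW := half_le_norm_log hz hz1
    set W := ‖Complex.log z‖ with hWdef
    have hW0 : 0 < W := by linarith
    rw [Metric.mem_ball, dist_eq_norm] at hα
    have hre : |α.re| ≤ |α₀.re| + 1 := by
      have := (Complex.abs_re_le_norm (α - α₀)).trans hα.le
      rw [Complex.sub_re] at this
      linarith [abs_sub_abs_le_abs_sub α.re α₀.re]
    have him : |α.im| ≤ |α₀.im| + 1 := by
      have := (Complex.abs_im_le_norm (α - α₀)).trans hα.le
      rw [Complex.sub_im] at this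
      linarith [abs_sub_abs_le_abs_sub α.im α₀.im]
    -- `W + W⁻¹` bounds `|log W|`, and `π ≤ 4 ≤ 8W` bounds the argument.
    have hloglog : ‖Complex.log (Complex.log z)‖ ≤ 9 * W + W ^ (-1 : ℝ) * 1 := by
      have hinv : (0 : ℝ) < W⁻¹ := by positivity
      have h2 : Real.log W ≤ W := (Real.log_le_sub_one_of_pos hW0).trans (by linarith)
      have h3 : -Real.log W ≤ W⁻¹ := by
        rw [← Real.log_inv]
        exact (Real.log_le_sub_one_of_pos hinv).trans (by linarith)
      have h4 := norm_complex_log_le (Complex.log z)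
      have h5 : |Real.log ‖Complex.log z‖| ≤ W + W⁻¹ := abs_le.mpr ⟨by linarith, by linarith⟩
      rw [Real.rpow_neg_one]
      linarith [Real.pi_le_four]
    have hb1 := hle z hz hz1 (α.re + 1) (by
      have := abs_add_le α.re 1
      rw [abs_one] at this
      linarith)
    have hb2 := hle z hz hz1 (α.re - 1) (by
      have := abs_sub α.re 1
      rw [abs_one] at this
      linarith)
    rw [Real.rpow_add hW0, Real.rpow_one] at hb1
    rw [sub_eq_add_neg, Real.rpow_add hW0] at hb2
    have hf := norm_hurwitzIntegrand_le α β x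
    rw [← hzdef, ← hWdef] at hf
    rw [norm_mul]
    calc ‖hurwitzIntegrand α β x‖ * ‖Complex.log (Complex.log z)‖
        ≤ (M * (‖z‖ ^ β.re * W ^ α.re)) * (9 * W + W ^ (-1 : ℝ) * 1) := by
          gcongr
          refine hf.trans ?_
          rw [hM]
          gcongr
      _ = M * (9 * (‖z‖ ^ β.re * (W ^ α.re * W)) +
            1 * (‖z‖ ^ β.re * (W ^ α.re * W ^ (-1 : ℝ)))) := by ring
      _ ≤ M * (9 * (C * ‖z‖ ^ (-γ)) + 1 * (C * ‖z‖ ^ (-γ))) := by gcongr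
      _ = _ := by ring
  · filter_upwards [ae_abs_lt_pi_div_two] with x hx hm α hα
    have hz := one_add_exp_ne_zero (hx hm)
    have hW := half_le_norm_log hz (norm_one_add_exp_sub_one x)
    have hw : Complex.log (1 + Complex.exp (-2 * Complex.I * x)) ≠ 0 := by
      rw [← norm_pos_iff]; linarith
    have := ((hasDerivAt_id α).const_cpow (Or.inl hw)).const_mul
      ((1 + Complex.exp (-2 * Complex.I * x)) ^ β)
    refine this.congr_deriv ?_
    simp [hurwitzIntegrand, mul_assoc]

/-! ### The Gamma integral with a complex rate. -/

theorem norm_cpow_mul_exp_neg {s r : ℂ} {t : ℝ} (ht : 0 < t) :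
    ‖(t : ℂ) ^ (s - 1) * Complex.exp (-(r * t))‖ = t ^ (s.re - 1) * Real.exp (-r.re * t) := by
  rw [norm_mul, Complex.norm_cpow_eq_rpow_re_of_pos ht, Complex.norm_exp]
  simp

theorem integrableOn_rpow_mul_exp_neg {σ b : ℝ} (hσ : 0 < σ) (hb : 0 < b) :
    IntegrableOn (fun t : ℝ => t ^ (σ - 1) * Real.exp (-b * t)) (Set.Ioi 0) := by
  simpa using integrableOn_rpow_mul_exp_neg_mul_rpow (p := 1) (s := σ - 1) (b := b)
    (by linarith) one_pos hb

theorem measurable_cpow_mul_exp_neg (s r : ℂ) :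
    Measurable (fun t : ℝ => (t : ℂ) ^ (s - 1) * Complex.exp (-(r * t))) := by
  fun_prop

theorem integrableOn_cpow_mul_exp_neg {s r : ℂ} (hs : 0 < s.re) (hr : 0 < r.re) :
    IntegrableOn (fun t : ℝ => (t : ℂ) ^ (s - 1) * Complex.exp (-(r * t))) (Set.Ioi 0) := by
  refine (integrableOn_rpow_mul_exp_neg hs hr).mono'
    (measurable_cpow_mul_exp_neg s r).aestronglyMeasurable ?_
  filter_upwards [ae_restrict_mem measurableSet_Ioi] with t ht
  exact (norm_cpow_mul_exp_neg ht).le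

theorem differentiableOn_integral_cpow_mul_exp_neg {s : ℂ} (hs : 0 < s.re) :
    DifferentiableOn ℂ (fun r : ℂ => ∫ t in Set.Ioi (0 : ℝ),
      (t : ℂ) ^ (s - 1) * Complex.exp (-(r * t))) {r | 0 < r.re} := by
  intro r hr
  have hr : 0 < r.re := hr
  refine (hasDerivAt_integral_of_dominated_loc_of_deriv_le
    (F' := fun r t => (t : ℂ) ^ (s - 1) * (Complex.exp (-(r * t)) * -(t : ℂ)))
    (bound := fun t => t ^ ((s.re + 1) - 1) * Real.exp (-(r.re / 2) * t))
    (Metric.ball_mem_nhds r (half_pos hr))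
    (Eventually.of_forall fun r => (measurable_cpow_mul_exp_neg s r).aestronglyMeasurable)
    (integrableOn_cpow_mul_exp_neg hs hr) ?_ ?_
    (integrableOn_rpow_mul_exp_neg (by linarith) (half_pos hr))
    ?_).2.differentiableAt.differentiableWithinAt
  · exact Measurable.aestronglyMeasurable (by fun_prop)
  · filter_upwards [ae_restrict_mem measurableSet_Ioi] with t ht r' hr'
    have ht : 0 < t := ht
    rw [Metric.mem_ball, dist_eq_norm] at hr'
    have h1 := (neg_le_of_abs_le ((Complex.abs_re_le_norm (r' - r)).trans hr'.le))
    rw [Complex.sub_re] at h1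
    rw [← mul_assoc, norm_mul, norm_cpow_mul_exp_neg ht, norm_neg, Complex.norm_real,
      Real.norm_of_nonneg ht.le, add_sub_right_comm, Real.rpow_add_one ht.ne', mul_right_comm]
    gcongr
    linarith
  · refine ae_of_all _ fun t r' _ => HasDerivAt.const_mul _ (HasDerivAt.cexp ?_)
    simpa using ((hasDerivAt_id r').mul_const (t : ℂ)).fun_neg

/-- Both sides are holomorphic in `r` on the right half-plane and agree on the positive reals, which
accumulate at 1. -/
theorem integral_cpow_mul_exp_neg_complex {s r : ℂ} (hs : 0 < s.re) (hr : 0 < r.re) :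
    ∫ t in Set.Ioi (0 : ℝ), (t : ℂ) ^ (s - 1) * Complex.exp (-(r * t)) =
      1 / r ^ s * Complex.Gamma s := by
  have hopen : IsOpen {r : ℂ | 0 < r.re} := isOpen_lt continuous_const Complex.continuous_re
  have hconn : IsPreconnected {r : ℂ | 0 < r.re} :=
    (convex_halfSpace_re_gt 0).isPreconnected
  have hG : DifferentiableOn ℂ (fun r : ℂ => 1 / r ^ s * Complex.Gamma s) {r | 0 < r.re} := by
    intro z hz
    have hz' : z ∈ Complex.slitPlane := Or.inl hz
    have hz0 : z ^ s ≠ 0 := by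
      rw [Complex.cpow_def_of_ne_zero (Complex.slitPlane_ne_zero hz')]
      exact Complex.exp_ne_zero _
    have hd : DifferentiableAt ℂ (fun r : ℂ => r ^ s) z :=
      differentiableAt_id.cpow_const hz'
    exact (((differentiableAt_const _).div hd hz0).mul_const _).differentiableWithinAt
  refine ((differentiableOn_integral_cpow_mul_exp_neg hs).analyticOnNhd
    hopen).eqOn_of_preconnected_of_frequently_eq (hG.analyticOnNhd hopen) hconn
    (z₀ := 1) (by simp) ?_ hr
  have hreal : ∀ x : ℝ, 0 < x → ∫ t in Set.Ioi (0 : ℝ),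
      (t : ℂ) ^ (s - 1) * Complex.exp (-((x : ℂ) * t)) = 1 / (x : ℂ) ^ s * Complex.Gamma s := by
    intro x hx
    rw [Complex.integral_cpow_mul_exp_neg_mul_Ioi hs hx, one_div, Complex.inv_cpow, one_div]
    rw [Complex.arg_ofReal_of_nonneg hx.le]
    exact Real.pi_pos.ne
  have ht : Tendsto (fun x : ℝ => (x : ℂ)) (𝓝[≠] 1) (𝓝[≠] (1 : ℂ)) := by
    refine tendsto_nhdsWithin_iff.mpr ⟨?_, ?_⟩
    · exact (Complex.continuous_ofReal.tendsto' 1 1 (by simp)).mono_left nhdsWithin_le_nhds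
    · filter_upwards [self_mem_nhdsWithin] with x hx
      simpa using hx
  refine ht.frequently (Eventually.frequently ?_)
  filter_upwards [nhdsWithin_le_nhds (lt_mem_nhds (zero_lt_one (α := ℝ)))] with x hx
  exact hreal x hx

/-! ### The Mellin transform of the Hurwitz kernel. -/

/-- The function whose Mellin transform is `Γ(s) ζ(s, a)`. -/
noncomputable def hurwitzKernel (a : ℂ) (t : ℝ) : ℂ :=
  Complex.exp (-(a * t)) / (1 - Complex.exp (-t))

theorem one_sub_exp_neg_pos {t : ℝ} (ht : 0 < t) : 0 < 1 - Real.exp (-t) := by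
  have : Real.exp (-t) < 1 := by simpa using ht
  linarith

theorem one_sub_cexp_neg_ne_zero {t : ℝ} (ht : 0 < t) : 1 - Complex.exp (-t) ≠ 0 := by
  have := (one_sub_exp_neg_pos ht).ne'
  exact_mod_cast this

theorem norm_hurwitzKernel (a : ℂ) {t : ℝ} (ht : 0 < t) :
    ‖hurwitzKernel a t‖ = Real.exp (-a.re * t) / (1 - Real.exp (-t)) := by
  have e : (1 - Complex.exp (-t) : ℂ) = ((1 - Real.exp (-t) : ℝ) : ℂ) := by push_cast; rfl
  rw [hurwitzKernel, norm_div, e, Complex.norm_real,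
    Real.norm_of_nonneg (one_sub_exp_neg_pos ht).le, Complex.norm_exp]
  simp

theorem continuousOn_hurwitzKernel (a : ℂ) : ContinuousOn (hurwitzKernel a) (Set.Ioi 0) := by
  unfold hurwitzKernel
  refine ContinuousOn.div (by fun_prop) (by fun_prop) fun t ht => one_sub_cexp_neg_ne_zero ht

theorem hurwitzKernel_isBigO_atTop (a : ℂ) :
    hurwitzKernel a =O[atTop] fun t => Real.exp (-a.re * t) := by
  refine Asymptotics.IsBigO.of_bound 2 ?_
  filter_upwards [eventually_ge_atTop 1] with t ht
  have ht0 : 0 < t := by linarith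
  have h2 : Real.exp (-t) ≤ 1 / 2 := by
    rw [Real.exp_neg, one_div]
    exact inv_anti₀ (by norm_num) (by linarith [Real.add_one_le_exp t])
  rw [norm_hurwitzKernel a ht0, Real.norm_of_nonneg (Real.exp_pos _).le,
    div_le_iff₀ (one_sub_exp_neg_pos ht0)]
  nlinarith [Real.exp_pos (-a.re * t)]

theorem hurwitzKernel_isBigO_zero {a : ℂ} (ha : 0 < a.re) :
    hurwitzKernel a =O[𝓝[>] 0] fun t => t ^ (-1 : ℝ) := by
  refine Asymptotics.IsBigO.of_bound (Real.exp 1) ?_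
  filter_upwards [Ioo_mem_nhdsGT (zero_lt_one (α := ℝ))] with t ht
  have ht0 : 0 < t := ht.1
  have h1 : Real.exp (-a.re * t) ≤ 1 := Real.exp_le_one_iff.mpr (by nlinarith)
  have h2 : t * Real.exp (-t) ≤ 1 - Real.exp (-t) := by
    have := Real.add_one_le_exp t
    have h3 : Real.exp t * Real.exp (-t) = 1 := by rw [← Real.exp_add]; simp
    nlinarith [Real.exp_pos (-t)]
  have h4 : Real.exp (-1) ≤ Real.exp (-t) := Real.exp_le_exp.mpr (by linarith [ht.2])
  rw [norm_hurwitzKernel a ht0, Real.rpow_neg_one, Real.norm_of_nonneg (by positivity)]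
  have hpos : 0 < t * Real.exp (-1) := by positivity
  calc _ ≤ 1 / (t * Real.exp (-1)) := by
        gcongr
        exact (by gcongr : t * Real.exp (-1) ≤ t * Real.exp (-t)).trans h2
    _ = Real.exp 1 * t⁻¹ := by
      rw [Real.exp_neg]; field_simp

theorem mellinConvergent_hurwitzKernel {a s : ℂ} (ha : 0 < a.re) (hs : 1 < s.re) :
    MellinConvergent (hurwitzKernel a) s :=
  mellinConvergent_of_isBigO_rpow_exp ha
    ((continuousOn_hurwitzKernel a).locallyIntegrableOn measurableSet_Ioi)
    (hurwitzKernel_isBigO_atTop a) (hurwitzKernel_isBigO_zero ha) hs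

theorem differentiableAt_mellin_hurwitzKernel {a s : ℂ} (ha : 0 < a.re) (hs : 1 < s.re) :
    DifferentiableAt ℂ (mellin (hurwitzKernel a)) s :=
  mellin_differentiableAt_of_isBigO_rpow_exp ha
    ((continuousOn_hurwitzKernel a).locallyIntegrableOn measurableSet_Ioi)
    (hurwitzKernel_isBigO_atTop a) (hurwitzKernel_isBigO_zero ha) hs

/-- Expand `1 / (1 - e^(-t))` as a geometric series and integrate termwise; the norms integrate to
`Γ(σ) (n + Re a) ^ (-σ)` with `σ = Re s`, which is summable. -/
theorem hasSum_cpow_mellin_hurwitzKernel {a s : ℂ} (ha : 0 < a.re) (hs : 1 < s.re) :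
    HasSum (fun n : ℕ => 1 / ((n : ℂ) + a) ^ s) (mellin (hurwitzKernel a) s / Complex.Gamma s) := by
  have hs0 : 0 < s.re := by linarith
  have hre : ∀ n : ℕ, 0 < ((n : ℂ) + a).re := fun n => by
    simp only [Complex.add_re, Complex.natCast_re]; positivity
  have hsum := hasSum_integral_of_summable_integral_norm (μ := volume.restrict (Set.Ioi (0 : ℝ)))
    (F := fun (n : ℕ) (t : ℝ) => (t : ℂ) ^ (s - 1) * Complex.exp (-(((n : ℂ) + a) * t)))
    (fun n => integrableOn_cpow_mul_exp_neg hs0 (hre n)) ?_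
  · have hG := Complex.Gamma_ne_zero_of_re_pos hs0
    have h2 := hsum.div_const (Complex.Gamma s)
    have e1 : ∀ n : ℕ, (∫ t in Set.Ioi (0 : ℝ),
        (t : ℂ) ^ (s - 1) * Complex.exp (-(((n : ℂ) + a) * t))) / Complex.Gamma s =
          1 / ((n : ℂ) + a) ^ s := fun n => by
      rw [integral_cpow_mul_exp_neg_complex hs0 (hre n), mul_div_cancel_right₀ _ hG]
    have e2 : mellin (hurwitzKernel a) s = ∫ t in Set.Ioi (0 : ℝ),
        ∑' n : ℕ, (t : ℂ) ^ (s - 1) * Complex.exp (-(((n : ℂ) + a) * t)) := by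
      refine setIntegral_congr_fun measurableSet_Ioi fun t ht => ?_
      have ht : 0 < t := ht
      have hlt : ‖Complex.exp (-t)‖ < 1 := by
        rw [Complex.norm_exp]
        simpa using ht
      have hg := ((hasSum_geometric_of_norm_lt_one hlt).mul_left
        ((t : ℂ) ^ (s - 1) * Complex.exp (-(a * t)))).tsum_eq
      simp only [hurwitzKernel, smul_eq_mul]
      rw [div_eq_mul_inv, ← mul_assoc, ← hg]
      congr 1
      ext n
      rw [mul_assoc, ← Complex.exp_nat_mul, ← Complex.exp_add]
      ring_nf
    rw [e2]
    simpa only [e1] using h2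
  · have hnorm : ∀ n : ℕ, ∫ t in Set.Ioi (0 : ℝ),
        ‖(t : ℂ) ^ (s - 1) * Complex.exp (-(((n : ℂ) + a) * t))‖ =
          1 / ((n : ℝ) + a.re) ^ s.re * Real.Gamma s.re := by
      intro n
      have hp : 0 < (n : ℝ) + a.re := by positivity
      rw [setIntegral_congr_fun measurableSet_Ioi fun t ht => norm_cpow_mul_exp_neg ht]
      have := Real.integral_rpow_mul_exp_neg_mul_Ioi hs0 hp
      rw [Real.div_rpow zero_le_one hp.le, Real.one_rpow] at this
      simpa only [Complex.add_re, Complex.natCast_re, neg_mul] using this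
    simp_rw [hnorm]
    refine Summable.mul_right _ ?_
    simpa [one_div, abs_of_pos, add_pos_of_nonneg_of_pos, ha] using
      (Real.summable_one_div_nat_add_rpow a.re s.re).mpr hs

/-! ### The holomorphic integrand in the strip and Cauchy's theorem. -/

theorem one_add_mem_slitPlane {u : ℂ} (hu : -1 < u.re) : 1 + u ∈ Complex.slitPlane :=
  Or.inl (by simp only [Complex.add_re, Complex.one_re]; linarith)

/-- The quotient is `∫₀¹ dt / (1 + tu)`; each `1 + tu` lies in the right half-plane, which inversion
preserves. -/
theorem re_log_one_add_div_pos {u : ℂ} (hu : -1 < u.re) (h0 : u ≠ 0) :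
    0 < (Complex.log (1 + u) / u).re := by
  rw [Complex.log_eq_integral (one_add_mem_slitPlane hu), mul_div_cancel_left₀ _ h0]
  have hre : ∀ t ∈ Set.Icc (0 : ℝ) 1, 0 < (1 + t • u).re := by
    intro t ht
    simp only [Complex.add_re, Complex.one_re, Complex.real_smul, Complex.re_ofReal_mul]
    rcases ht.2.lt_or_eq with h | rfl
    · nlinarith [ht.1]
    · linarith
  have hc : ContinuousOn (fun t : ℝ => (1 + t • u)⁻¹) (Set.Icc 0 1) := by
    refine ContinuousOn.inv₀ (by fun_prop) fun t ht h => ?_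
    have := hre t ht
    rw [h] at this
    simp at this
  have hi : IntervalIntegrable (fun t : ℝ => (1 + t • u)⁻¹) volume 0 1 :=
    ContinuousOn.intervalIntegrable (by rwa [Set.uIcc_of_le zero_le_one])
  have hcomm := Complex.reCLM.intervalIntegral_comp_comm hi
  simp only [Complex.reCLM_apply] at hcomm
  rw [← hcomm]
  refine intervalIntegral.intervalIntegral_pos_of_pos_on ?_ ?_ one_pos
  · refine ContinuousOn.intervalIntegrable ?_
    rw [Set.uIcc_of_le zero_le_one]
    exact Complex.continuous_re.comp_continuousOn hc
  · intro t ht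
    have h := hre t (Set.Ioo_subset_Icc_self ht)
    rw [Complex.inv_re]
    refine div_pos h (Complex.normSq_pos.mpr fun h' => ?_)
    rw [h'] at h
    simp at h

/-- The integrand `z ^ β * log z ^ α` in the coordinate `z = 1 + exp ζ`, continued from
`|Im ζ| < π` to the closed strip. -/
noncomputable def stripIntegrand (α β ζ : ℂ) : ℂ :=
  (1 + Complex.exp ζ) ^ β * Complex.exp (α * ζ) *
    (Complex.log (1 + Complex.exp ζ) / Complex.exp ζ) ^ α

theorem neg_one_lt_re_exp {ζ : ℂ} (hζ : ζ.re < 0) : -1 < (Complex.exp ζ).re := by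
  have h := Complex.abs_re_le_norm (Complex.exp ζ)
  have h1 : ‖Complex.exp ζ‖ < 1 := by rw [Complex.norm_exp]; simpa using hζ
  linarith [neg_le_of_abs_le h]

theorem differentiableAt_stripIntegrand (α β : ℂ) {ζ : ℂ} (hζ : -1 < (Complex.exp ζ).re) :
    DifferentiableAt ℂ (stripIntegrand α β) ζ := by
  have hs := one_add_mem_slitPlane hζ
  have h1 : DifferentiableAt ℂ (fun ζ => 1 + Complex.exp ζ) ζ := by fun_prop
  unfold stripIntegrand
  refine ((h1.cpow_const hs).mul (by fun_prop)).mul (DifferentiableAt.cpow_const ?_ ?_)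
  · exact (h1.clog hs).div (by fun_prop) (Complex.exp_ne_zero ζ)
  · exact Or.inl (re_log_one_add_div_pos hζ (Complex.exp_ne_zero ζ))

/-- The values of `stripIntegrand` on both edges `Im ζ = ±π` of the strip, up to the factor
`exp (±iπα)`. -/
noncomputable def edgeIntegrand (α β : ℂ) (ρ : ℝ) : ℂ :=
  (1 - Complex.exp ρ) ^ β * Complex.exp (α * ρ) *
    (Complex.log (1 - Complex.exp ρ) / -Complex.exp ρ) ^ α

theorem stripIntegrand_add_pi (α β : ℂ) (ρ : ℝ) :
    stripIntegrand α β (ρ + Real.pi * Complex.I) =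
      Complex.exp (Real.pi * α * Complex.I) * edgeIntegrand α β ρ := by
  have e : Complex.exp (ρ + Real.pi * Complex.I) = -Complex.exp ρ := by
    rw [Complex.exp_add, Complex.exp_pi_mul_I, mul_neg_one]
  rw [stripIntegrand, edgeIntegrand, e, ← sub_eq_add_neg, mul_add, Complex.exp_add]
  ring_nf

theorem stripIntegrand_sub_pi (α β : ℂ) (ρ : ℝ) :
    stripIntegrand α β (ρ + (-Real.pi : ℝ) * Complex.I) =
      Complex.exp (-(Real.pi * α) * Complex.I) * edgeIntegrand α β ρ := by
  have e : Complex.exp (ρ + (-Real.pi : ℝ) * Complex.I) = -Complex.exp ρ := by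
    rw [Complex.exp_add]
    push_cast
    rw [neg_mul, Complex.exp_neg, Complex.exp_pi_mul_I]
    norm_num
  rw [stripIntegrand, edgeIntegrand, e, ← sub_eq_add_neg, mul_add, Complex.exp_add]
  push_cast
  ring_nf

theorem continuousOn_edgeIntegrand (α β : ℂ) : ContinuousOn (edgeIntegrand α β) (Set.Iio 0) := by
  have h : edgeIntegrand α β = fun ρ : ℝ => Complex.exp (-(Real.pi * α) * Complex.I) *
      stripIntegrand α β (ρ + Real.pi * Complex.I) := by
    ext ρ
    rw [stripIntegrand_add_pi, ← mul_assoc, ← Complex.exp_add]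
    simp
  rw [h]
  intro ρ hρ
  have hd := differentiableAt_stripIntegrand α β (ζ := ρ + Real.pi * Complex.I)
    (neg_one_lt_re_exp (by simpa using hρ))
  have hc : ContinuousAt (fun ρ : ℝ => (ρ + Real.pi * Complex.I : ℂ)) ρ := by fun_prop
  exact (continuousAt_const.mul
    (ContinuousAt.comp (f := fun ρ : ℝ => (ρ + Real.pi * Complex.I : ℂ))
      hd.continuousAt hc)).continuousWithinAt

/-- The integral of `stripIntegrand` over the vertical segment `Re ζ = ρ`, that is over the circle
`|z - 1| = exp ρ` cut at `z = 1 - exp ρ`. -/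
noncomputable def arcIntegral (α β : ℂ) (ρ : ℝ) : ℂ :=
  ∫ θ in (-Real.pi)..Real.pi, stripIntegrand α β (ρ + θ * Complex.I)

/-- On the horizontal edges `e^ζ = -e^ρ` alike, so Cauchy's theorem leaves the factor `e^(iπα) -
e^(-iπα) = 2i sin(πα)`. -/
theorem arcIntegral_eq_add (α β : ℂ) {ρ₁ ρ₂ : ℝ} (h₁ : ρ₁ < 0) (h₂ : ρ₂ < 0) :
    arcIntegral α β ρ₂ = arcIntegral α β ρ₁ +
      2 * Complex.sin (Real.pi * α) * ∫ ρ in ρ₁..ρ₂, edgeIntegrand α β ρ := by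
  have h := Complex.integral_boundary_rect_eq_zero_of_differentiableOn (stripIntegrand α β)
    ⟨ρ₁, -Real.pi⟩ ⟨ρ₂, Real.pi⟩ fun ζ hζ => by
      refine (differentiableAt_stripIntegrand α β
        (neg_one_lt_re_exp ?_)).differentiableWithinAt
      have := hζ.1.2
      exact this.trans_lt (max_lt h₁ h₂)
  simp only [stripIntegrand_add_pi, stripIntegrand_sub_pi,
    intervalIntegral.integral_const_mul] at h
  change _ - _ + Complex.I • arcIntegral α β ρ₂ - Complex.I • arcIntegral α β ρ₁ = 0 at h
  simp only [smul_eq_mul] at h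
  rw [Complex.sin]
  linear_combination (-Complex.I) * h +
    (arcIntegral α β ρ₂ - arcIntegral α β ρ₁) * Complex.I_sq

theorem edgeIntegrand_log (α β : ℂ) {t : ℝ} (ht : 0 < t) :
    edgeIntegrand α β (Real.log (1 - Real.exp (-t))) =
      (t : ℂ) ^ α * Complex.exp (-(β * t)) := by
  have hp := one_sub_exp_neg_pos ht
  set r := Real.log (1 - Real.exp (-t)) with hr
  have her : Real.exp r = 1 - Real.exp (-t) := Real.exp_log hp
  have e1 : (1 - Complex.exp r : ℂ) = (Real.exp (-t) : ℝ) := by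
    rw [← Complex.ofReal_exp, her]; push_cast; ring
  have e2 : Complex.log (1 - Complex.exp r) = ((-t : ℝ) : ℂ) := by
    rw [e1, ← Complex.ofReal_log (Real.exp_pos _).le, Real.log_exp]
  have e3 : ((-t : ℝ) : ℂ) / -Complex.exp r = ((t / Real.exp r : ℝ) : ℂ) := by
    push_cast; rw [neg_div_neg_eq]
  have e4 : ((Real.exp (-t) : ℝ) : ℂ) ^ β = Complex.exp (-(β * t)) := by
    rw [Complex.cpow_def_of_ne_zero (by exact_mod_cast (Real.exp_pos _).ne'),
      ← Complex.ofReal_log (Real.exp_pos _).le, Real.log_exp]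
    push_cast; ring_nf
  have e5 : Complex.exp (α * r) * ((t / Real.exp r : ℝ) : ℂ) ^ α = (t : ℂ) ^ α := by
    have hne : ((t / Real.exp r : ℝ) : ℂ) ≠ 0 := by
      exact_mod_cast (div_pos ht (Real.exp_pos r)).ne'
    rw [Complex.cpow_def_of_ne_zero hne, Complex.cpow_def_of_ne_zero (by exact_mod_cast ht.ne'),
      ← Complex.exp_add, ← Complex.ofReal_log (div_pos ht (Real.exp_pos r)).le,
      ← Complex.ofReal_log ht.le, Real.log_div ht.ne' (Real.exp_pos r).ne', Real.log_exp]
    push_cast; ring_nf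
  rw [edgeIntegrand, e2, e1, e3, e4, mul_assoc, e5, mul_comm]

/-- `dρ = e^(-t) / (1 - e^(-t)) dt`; the extra `e^(-t)` turns `β` into `β + 1`. -/
theorem integral_edgeIntegrand (α β : ℂ) {t₁ t₂ : ℝ} (h₁ : 0 < t₁) (h₂ : 0 < t₂) :
    ∫ ρ in (Real.log (1 - Real.exp (-t₁)))..(Real.log (1 - Real.exp (-t₂))),
        edgeIntegrand α β ρ =
      ∫ t in t₁..t₂, (t : ℂ) ^ (α + 1 - 1) • hurwitzKernel (β + 1) t := by
  have hpos : ∀ t ∈ Set.uIcc t₁ t₂, 0 < t := fun t ht => (lt_min h₁ h₂).trans_le ht.1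
  rw [← intervalIntegral.integral_deriv_smul_comp' (g := edgeIntegrand α β)
    (f := fun t => Real.log (1 - Real.exp (-t)))
    (f' := fun t => Real.exp (-t) / (1 - Real.exp (-t)))]
  · refine intervalIntegral.integral_congr fun t ht => ?_
    have ht0 := hpos t ht
    simp only [Function.comp, edgeIntegrand_log α β ht0, hurwitzKernel, smul_eq_mul,
      Complex.real_smul, add_sub_cancel_right]
    rw [add_mul, one_mul, neg_add, Complex.exp_add]
    push_cast
    ring
  · intro t ht
    have h : HasDerivAt (fun t : ℝ => 1 - Real.exp (-t)) (Real.exp (-t)) t := by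
      simpa using ((hasDerivAt_id t).fun_neg.exp).const_sub 1
    exact h.log (one_sub_exp_neg_pos (hpos t ht)).ne'
  · exact ContinuousOn.div (by fun_prop) (by fun_prop)
      fun t ht => (one_sub_exp_neg_pos (hpos t ht)).ne'
  · refine (continuousOn_edgeIntegrand α β).mono ?_
    rintro _ ⟨t, ht, rfl⟩
    have := one_sub_exp_neg_pos (hpos t ht)
    exact Real.log_neg this (by linarith [Real.exp_pos (-t)])

/-! ### Limits of the arc integrals. -/

/-- The powers of `e^(Re ζ)` cancel, leaving `|log z| ^ (Re α)`. Since `log z → 0` as `Re ζ → -∞`,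
boundedness there requires `Re α ≥ 0`. -/
theorem exists_norm_stripIntegrand_le {α β : ℂ} (hα : 0 ≤ α.re) (hβ : -1 < β.re) :
    ∃ γ C : ℝ, 0 ≤ γ ∧ γ < 1 ∧ 0 < C ∧ ∀ ζ : ℂ, ζ.re < 0 → |ζ.im| ≤ Real.pi →
      ‖stripIntegrand α β ζ‖ ≤ C * ‖1 + Complex.exp ζ‖ ^ (-γ) := by
  set b' := min β.re 0 with hb'
  have h1 : -1 < b' := lt_min hβ (by norm_num)
  have h0 : b' ≤ 0 := min_le_right _ _
  set δ := (b' + 1) / 2 with hδ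
  obtain ⟨C, hC, h⟩ := exists_one_add_norm_log_rpow_le (B := α.re + 1) (δ := δ) (by linarith)
    (by linarith)
  refine ⟨δ - b', Real.exp (Real.pi * |β.im|) * Real.exp (Real.pi * |α.im|) *
    Real.exp (Real.pi * |α.im|) * 2 ^ (β.re - b') * C, by linarith, by linarith, by positivity,
    fun ζ hζ hζi => ?_⟩
  set z := 1 + Complex.exp ζ with hz
  have hz0 : z ≠ 0 := Complex.slitPlane_ne_zero (one_add_mem_slitPlane (neg_one_lt_re_exp hζ))
  have hn : 0 < ‖z‖ := norm_pos_iff.mpr hz0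
  have hexp : ‖Complex.exp ζ‖ ≤ 1 := by rw [Complex.norm_exp]; simpa using hζ.le
  have hz2 : ‖z‖ ≤ 2 := by
    calc ‖z‖ ≤ ‖(1 : ℂ)‖ + ‖Complex.exp ζ‖ := norm_add_le _ _
      _ ≤ 2 := by rw [norm_one]; linarith
  set W := ‖Complex.log z‖ with hW
  have hW0 : 0 ≤ W := norm_nonneg _
  have hWle : W ^ α.re ≤ C * ‖z‖ ^ (-δ) := by
    refine le_trans ?_ (h z hz0 hz2)
    calc W ^ α.re ≤ (1 + W) ^ α.re := by gcongr; linarith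
      _ ≤ _ := Real.rpow_le_rpow_of_exponent_le (by linarith) (by linarith)
  have hbb : 0 ≤ β.re - b' := sub_nonneg.mpr (min_le_left _ _)
  have e1 : ‖z‖ ^ β.re ≤ 2 ^ (β.re - b') * ‖z‖ ^ b' := by
    calc ‖z‖ ^ β.re = ‖z‖ ^ (β.re - b') * ‖z‖ ^ b' := by rw [← Real.rpow_add hn]; ring_nf
      _ ≤ _ := by gcongr
  have e2 : ‖Complex.exp (α * ζ)‖ ≤
      Real.exp ζ.re ^ α.re * Real.exp (Real.pi * |α.im|) := by
    rw [Complex.norm_exp, ← Real.exp_mul, ← Real.exp_add, Complex.mul_re]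
    gcongr
    have : -(α.im * ζ.im) ≤ Real.pi * |α.im| := by
      calc -(α.im * ζ.im) ≤ |α.im * ζ.im| := neg_le_abs _
        _ = |ζ.im| * |α.im| := by rw [abs_mul, mul_comm]
        _ ≤ _ := by gcongr
    linarith
  have e3 : ‖(Complex.log z / Complex.exp ζ) ^ α‖ ≤
      (W / Real.exp ζ.re) ^ α.re * Real.exp (Real.pi * |α.im|) := by
    refine (norm_cpow_le_rpow_mul_exp _ _).trans (le_of_eq ?_)
    rw [norm_div, Complex.norm_exp]
  have e4 : Real.exp ζ.re ^ α.re * (W / Real.exp ζ.re) ^ α.re = W ^ α.re := by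
    rw [← Real.mul_rpow (Real.exp_pos _).le (by positivity), mul_div_cancel₀ _ (Real.exp_pos _).ne']
  rw [stripIntegrand, norm_mul, norm_mul]
  calc _ ≤ (‖z‖ ^ β.re * Real.exp (Real.pi * |β.im|)) *
        (Real.exp ζ.re ^ α.re * Real.exp (Real.pi * |α.im|)) *
        ((W / Real.exp ζ.re) ^ α.re * Real.exp (Real.pi * |α.im|)) := by
        gcongr
        exact norm_cpow_le_rpow_mul_exp _ _
    _ = Real.exp (Real.pi * |β.im|) * Real.exp (Real.pi * |α.im|) * Real.exp (Real.pi * |α.im|) *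
        (‖z‖ ^ β.re * (Real.exp ζ.re ^ α.re * (W / Real.exp ζ.re) ^ α.re)) := by ring
    _ = Real.exp (Real.pi * |β.im|) * Real.exp (Real.pi * |α.im|) * Real.exp (Real.pi * |α.im|) *
        (‖z‖ ^ β.re * W ^ α.re) := by rw [e4]
    _ ≤ Real.exp (Real.pi * |β.im|) * Real.exp (Real.pi * |α.im|) * Real.exp (Real.pi * |α.im|) *
        ((2 ^ (β.re - b') * ‖z‖ ^ b') * (C * ‖z‖ ^ (-δ))) := by gcongr
    _ = Real.exp (Real.pi * |β.im|) * Real.exp (Real.pi * |α.im|) * Real.exp (Real.pi * |α.im|) *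
        2 ^ (β.re - b') * C * (‖z‖ ^ b' * ‖z‖ ^ (-δ)) := by ring
    _ = _ := by rw [← Real.rpow_add hn]; ring_nf

/-- Moving from radius `e^ρ` to radius 1 adds `1 - e^ρ ≤ |1 + e^(ρ + iθ)|`. This gives a dominating
function independent of `ρ`. -/
theorem norm_one_add_exp_mul_I_le {ρ θ : ℝ} (hρ : ρ < 0) :
    ‖1 + Complex.exp (θ * Complex.I)‖ ≤ 2 * ‖1 + Complex.exp (ρ + θ * Complex.I)‖ := by
  have hexp : Real.exp ρ ≤ 1 := by simpa using hρ.le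
  have hn : ‖Complex.exp (ρ + θ * Complex.I)‖ = Real.exp ρ := by simp [Complex.norm_exp]
  have h1 : 1 - Real.exp ρ ≤ ‖1 + Complex.exp (ρ + θ * Complex.I)‖ := by
    have := norm_sub_le_norm_add (1 : ℂ) (Complex.exp (ρ + θ * Complex.I))
    rwa [norm_one, hn] at this
  have h2 : Complex.exp (θ * Complex.I) - Complex.exp (ρ + θ * Complex.I) =
      (1 - Real.exp ρ : ℝ) * Complex.exp (θ * Complex.I) := by
    rw [Complex.exp_add]; push_cast; ring
  have h3 : ‖Complex.exp (θ * Complex.I) - Complex.exp (ρ + θ * Complex.I)‖ = 1 - Real.exp ρ := by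
    rw [h2, norm_mul, Complex.norm_real, Complex.norm_exp_ofReal_mul_I, mul_one,
      Real.norm_of_nonneg (by linarith)]
  calc _ = ‖(1 + Complex.exp (ρ + θ * Complex.I)) +
        (Complex.exp (θ * Complex.I) - Complex.exp (ρ + θ * Complex.I))‖ := by congr 1; ring
    _ ≤ _ := norm_add_le _ _
    _ ≤ _ := by rw [h3]; linarith

theorem ae_abs_lt_pi : ∀ᵐ θ : ℝ ∂volume, θ ∈ Set.uIoc (-Real.pi) Real.pi → |θ| < Real.pi := by
  have : ∀ᵐ x : ℝ ∂volume, x ≠ Real.pi := by simp [ae_iff, measure_singleton]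
  filter_upwards [this] with x hx hm
  rw [Set.uIoc_of_le (by linarith [Real.pi_pos])] at hm
  exact abs_lt.mpr ⟨hm.1, lt_of_le_of_ne hm.2 hx⟩

theorem one_add_exp_mul_I_eq (θ : ℝ) :
    (1 + Complex.exp (θ * Complex.I)) =
      1 + Complex.exp (-2 * Complex.I * ((-(1 / 2) * θ : ℝ) : ℂ)) := by
  push_cast
  ring_nf

theorem intervalIntegrable_norm_one_add_exp_mul_I {γ : ℝ} (h0 : 0 ≤ γ) (h1 : γ < 1) :
    IntervalIntegrable (fun θ : ℝ => ‖1 + Complex.exp (θ * Complex.I)‖ ^ (-γ)) volume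
      (-Real.pi) Real.pi := by
  have h := (intervalIntegrable_norm_one_add_exp_rpow h0 h1).comp_mul_left (c := -(1 / 2))
  simp_rw [one_add_exp_mul_I_eq]
  convert h.symm using 1 <;> ring

theorem neg_one_lt_re_exp_mul_I {θ : ℝ} (hθ : |θ| < Real.pi) :
    -1 < (Complex.exp (θ * Complex.I)).re := by
  rw [Complex.exp_ofReal_mul_I_re, ← Real.cos_pi, ← Real.cos_abs θ]
  exact Real.cos_lt_cos_of_nonneg_of_le_pi (abs_nonneg θ) le_rfl hθ

theorem measurable_stripIntegrand (α β : ℂ) (ρ : ℝ) :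
    Measurable (fun θ : ℝ => stripIntegrand α β (ρ + θ * Complex.I)) := by
  unfold stripIntegrand
  fun_prop

theorem tendsto_arcIntegral {α β : ℂ} (hα : 0 ≤ α.re) (hβ : -1 < β.re) {l : Filter ℝ}
    [l.IsCountablyGenerated] (hl : ∀ᶠ ρ in l, ρ < 0) {f : ℝ → ℂ}
    (hf : ∀ θ : ℝ, |θ| < Real.pi →
      Tendsto (fun ρ : ℝ => stripIntegrand α β (ρ + θ * Complex.I)) l (𝓝 (f θ))) :
    Tendsto (arcIntegral α β) l (𝓝 (∫ θ in (-Real.pi)..Real.pi, f θ)) := by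
  obtain ⟨γ, C, h0, h1, hC, hle⟩ := exists_norm_stripIntegrand_le hα hβ
  refine intervalIntegral.tendsto_integral_filter_of_dominated_convergence _
    (Eventually.of_forall fun ρ => (measurable_stripIntegrand α β ρ).aestronglyMeasurable) ?_
    ((intervalIntegrable_norm_one_add_exp_mul_I h0 h1).const_mul (C * 2 ^ γ)) ?_
  · filter_upwards [hl] with ρ hρ
    filter_upwards [ae_abs_lt_pi] with θ hθ hm
    have hz : 0 < ‖1 + Complex.exp (θ * Complex.I)‖ := norm_pos_iff.mpr
      (Complex.slitPlane_ne_zero (one_add_mem_slitPlane (neg_one_lt_re_exp_mul_I (hθ hm))))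
    refine (hle (ρ + θ * Complex.I) (by simpa using hρ) (by simpa using (hθ hm).le)).trans ?_
    rw [mul_assoc]
    gcongr
    have hhalf : ‖1 + Complex.exp (θ * Complex.I)‖ / 2 ≤
        ‖1 + Complex.exp (ρ + θ * Complex.I)‖ := by
      linarith [norm_one_add_exp_mul_I_le (θ := θ) hρ]
    refine (Real.rpow_le_rpow_of_nonpos (by positivity) hhalf (by linarith)).trans (le_of_eq ?_)
    rw [Real.div_rpow hz.le (by norm_num), Real.rpow_neg (by norm_num : (0 : ℝ) ≤ 2), div_inv_eq_mul,
      mul_comm]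
  · filter_upwards [ae_abs_lt_pi] with θ hθ hm
    exact hf θ (hθ hm)

theorem tendsto_arcIntegral_zero {α β : ℂ} (hα : 0 ≤ α.re) (hβ : -1 < β.re) :
    Tendsto (arcIntegral α β) (𝓝[<] 0) (𝓝 (arcIntegral α β 0)) := by
  refine tendsto_arcIntegral hα hβ self_mem_nhdsWithin fun θ hθ => ?_
  have hd : ContinuousAt (stripIntegrand α β) ((fun ρ : ℝ => (ρ + θ * Complex.I : ℂ)) 0) := by
    refine (differentiableAt_stripIntegrand α β ?_).continuousAt
    simpa using neg_one_lt_re_exp_mul_I hθ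
  have hc : ContinuousAt (fun ρ : ℝ => (ρ + θ * Complex.I : ℂ)) 0 := by fun_prop
  exact (ContinuousAt.comp (f := fun ρ : ℝ => (ρ + θ * Complex.I : ℂ)) hd
    hc).tendsto.mono_left nhdsWithin_le_nhds

theorem tendsto_log_one_add_div : Tendsto (fun u : ℂ => Complex.log (1 + u) / u) (𝓝[≠] 0) (𝓝 1) := by
  have h : HasDerivAt (fun u : ℂ => Complex.log (1 + u)) 1 0 := by
    have h1 : HasDerivAt (fun u : ℂ => 1 + u) 1 0 := (hasDerivAt_id 0).const_add 1
    simpa using h1.clog (by simp)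
  refine h.tendsto_slope.congr fun u => ?_
  simp [slope_def_field]

/-- The other two factors tend to 1 as `e^ζ → 0`, so `e^(αζ)` alone decides: the limit is 0 for `Re
α > 0` and 1 for `α = 0`. -/
theorem tendsto_stripIntegrand_atBot {α : ℂ} (β : ℂ) {c : ℂ} {θ : ℝ}
    (h : Tendsto (fun ρ : ℝ => Complex.exp (α * (ρ + θ * Complex.I))) atBot (𝓝 c)) :
    Tendsto (fun ρ : ℝ => stripIntegrand α β (ρ + θ * Complex.I)) atBot (𝓝 c) := by
  have hu : Tendsto (fun ρ : ℝ => Complex.exp (ρ + θ * Complex.I)) atBot (𝓝[≠] 0) := by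
    refine tendsto_nhdsWithin_iff.mpr ⟨?_, Eventually.of_forall fun ρ => Complex.exp_ne_zero _⟩
    rw [tendsto_zero_iff_norm_tendsto_zero]
    simpa [Complex.norm_exp] using Real.tendsto_exp_atBot
  have h1 : Tendsto (fun u : ℂ => (1 + u) ^ β) (𝓝[≠] 0) (𝓝 1) := by
    have : ContinuousAt (fun u : ℂ => (1 + u) ^ β) 0 :=
      ContinuousAt.cpow (by fun_prop) continuousAt_const (by simp)
    have h := this.tendsto
    simp only [add_zero, Complex.one_cpow] at h
    exact h.mono_left nhdsWithin_le_nhds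
  have h2 : Tendsto (fun u : ℂ => (Complex.log (1 + u) / u) ^ α) (𝓝[≠] 0) (𝓝 1) := by
    have hc : ContinuousAt (fun v : ℂ => v ^ α) 1 :=
      ContinuousAt.cpow continuousAt_id continuousAt_const (by simp)
    simpa [Function.comp_def] using hc.tendsto.comp tendsto_log_one_add_div
  simpa [stripIntegrand, Function.comp_def] using ((h1.comp hu).mul h).mul (h2.comp hu)

theorem tendsto_arcIntegral_atBot {α β : ℂ} (hα : 0 < α.re) (hβ : -1 < β.re) :
    Tendsto (arcIntegral α β) atBot (𝓝 0) := by
  have := tendsto_arcIntegral hα.le hβ (eventually_lt_atBot 0) (f := fun _ => 0) fun θ _ => by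
    refine tendsto_stripIntegrand_atBot β ?_
    rw [tendsto_zero_iff_norm_tendsto_zero]
    have h1 : Tendsto (fun ρ : ℝ => α.re * ρ - α.im * θ) atBot atBot :=
      tendsto_atBot_add_const_right _ _ (tendsto_id.const_mul_atBot hα)
    refine (Real.tendsto_exp_atBot.comp h1).congr fun ρ => ?_
    simp [Complex.norm_exp]
  simpa using this

theorem tendsto_arcIntegral_zero_atBot {β : ℂ} (hβ : -1 < β.re) :
    Tendsto (arcIntegral 0 β) atBot (𝓝 (2 * Real.pi)) := by
  have := tendsto_arcIntegral (α := 0) (by simp) hβ (eventually_lt_atBot 0) (f := fun _ => 1)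
    fun θ _ => tendsto_stripIntegrand_atBot β (by simp)
  convert this using 2
  simp
  ring

/-! ### The unit circle and the contour identity. -/

theorem exp_mul_div_exp_cpow {w : ℂ} (hw : w ≠ 0) (α : ℂ) {θ : ℝ}
    (h : w.arg - θ ∈ Set.Ioc (-Real.pi) Real.pi) :
    Complex.exp (α * (θ * Complex.I)) * (w / Complex.exp (θ * Complex.I)) ^ α = w ^ α := by
  have e : Complex.exp (Complex.log w - θ * Complex.I) = w / Complex.exp (θ * Complex.I) := by
    rw [Complex.exp_sub, Complex.exp_log hw]
  have hlog : Complex.log (w / Complex.exp (θ * Complex.I)) = Complex.log w - θ * Complex.I := by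
    rw [← e]
    refine Complex.log_exp ?_ ?_
    · simpa [Complex.log_im] using h.1
    · simpa [Complex.log_im] using h.2
  rw [Complex.cpow_def_of_ne_zero (div_ne_zero hw (Complex.exp_ne_zero _)), hlog,
    Complex.cpow_def_of_ne_zero hw, ← Complex.exp_add]
  ring_nf

theorem stripIntegrand_mul_I (α β : ℂ) {θ : ℝ} (hθ : |θ| < Real.pi) :
    stripIntegrand α β (θ * Complex.I) = hurwitzIntegrand α β (-(1 / 2) * θ) := by
  have hθ' := abs_lt.mp hθ
  have hre := neg_one_lt_re_exp_mul_I hθ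
  have hz := Complex.slitPlane_ne_zero (one_add_mem_slitPlane hre)
  have hw : Complex.log (1 + Complex.exp (θ * Complex.I)) ≠ 0 := by
    intro h
    have := re_log_one_add_div_pos hre (Complex.exp_ne_zero _)
    simp [h] at this
  have him : (Complex.log (1 + Complex.exp (θ * Complex.I))).im =
      (1 + Complex.exp (θ * Complex.I)).arg := Complex.log_im _
  have hsin : (1 + Complex.exp (θ * Complex.I)).im = Real.sin θ := by
    simp [Complex.exp_ofReal_mul_I_im]
  rw [hurwitzIntegrand, ← one_add_exp_mul_I_eq, stripIntegrand, mul_assoc,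
    exp_mul_div_exp_cpow hw]
  set w := Complex.log (1 + Complex.exp (θ * Complex.I))
  -- Since `Im z = sin θ`, the numbers `arg z = Im w`, `arg w` and `θ` lie on the same side of 0, so
  -- `arg w - θ` stays in the principal range.
  rcases le_or_gt 0 θ with h | h
  · have h1 : 0 ≤ w.im := by
      rw [him, Complex.arg_nonneg_iff, hsin]
      exact Real.sin_nonneg_of_nonneg_of_le_pi h hθ'.2.le
    have h2 := Complex.arg_nonneg_iff.mpr h1
    have h3 := Complex.arg_le_pi w
    exact ⟨by linarith, by linarith⟩
  · have h1 : w.im < 0 := by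
      rw [him, Complex.arg_neg_iff, hsin]
      exact Real.sin_neg_of_neg_of_neg_pi_lt h hθ'.1
    have h2 := Complex.arg_neg_iff.mpr h1
    have h3 := Complex.neg_pi_lt_arg w
    exact ⟨by linarith, by linarith⟩

theorem arcIntegral_zero (α β : ℂ) :
    arcIntegral α β 0 =
      2 * ∫ x in (-(Real.pi / 2))..(Real.pi / 2), hurwitzIntegrand α β x := by
  have h1 : arcIntegral α β 0 =
      ∫ θ in (-Real.pi)..Real.pi, hurwitzIntegrand α β (-(1 / 2) * θ) := by
    refine intervalIntegral.integral_congr_ae ?_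
    filter_upwards [ae_abs_lt_pi] with θ hθ hm
    simpa using stripIntegrand_mul_I α β (hθ hm)
  rw [h1, intervalIntegral.integral_comp_mul_left _ (by norm_num), intervalIntegral.integral_symm]
  rw [show -(1 / 2) * Real.pi = -(Real.pi / 2) by ring,
    show -(1 / 2) * -Real.pi = Real.pi / 2 by ring, Complex.real_smul]
  push_cast
  ring

theorem tendsto_log_one_sub_exp_neg_atTop :
    Tendsto (fun t : ℝ => Real.log (1 - Real.exp (-t))) atTop (𝓝[<] 0) := by
  refine tendsto_nhdsWithin_iff.mpr ⟨?_, ?_⟩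
  · have h : Tendsto (fun t : ℝ => 1 - Real.exp (-t)) atTop (𝓝 1) := by
      simpa using (Real.tendsto_exp_neg_atTop_nhds_zero).const_sub 1
    simpa using h.log one_ne_zero
  · filter_upwards [eventually_gt_atTop 0] with t ht
    exact Real.log_neg (one_sub_exp_neg_pos ht) (by linarith [Real.exp_pos (-t)])

theorem tendsto_log_one_sub_exp_neg_zero :
    Tendsto (fun t : ℝ => Real.log (1 - Real.exp (-t))) (𝓝[>] 0) atBot := by
  refine Real.tendsto_log_nhdsGT_zero.comp (tendsto_nhdsWithin_iff.mpr ⟨?_, ?_⟩)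
  · have h : Continuous (fun t : ℝ => 1 - Real.exp (-t)) := by fun_prop
    exact (h.tendsto' 0 0 (by simp)).mono_left nhdsWithin_le_nhds
  · filter_upwards [self_mem_nhdsWithin] with t ht
    exact one_sub_exp_neg_pos ht

theorem integral_hurwitzIntegrand_eq_mellin {α β : ℂ} (hα : 0 < α.re) (hβ : -1 < β.re) :
    ∫ x in (-(Real.pi / 2))..(Real.pi / 2), hurwitzIntegrand α β x =
      Complex.sin (Real.pi * α) * mellin (hurwitzKernel (β + 1)) (α + 1) := by
  have hM : IntegrableOn (fun t : ℝ => (t : ℂ) ^ (α + 1 - 1) • hurwitzKernel (β + 1) t)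
      (Set.Ioi 0) := mellinConvergent_hurwitzKernel
    (by simp only [Complex.add_re, Complex.one_re]; linarith)
    (by simp only [Complex.add_re, Complex.one_re]; linarith)
  have hneg : ∀ t : ℝ, 0 < t → Real.log (1 - Real.exp (-t)) < 0 := fun t ht =>
    Real.log_neg (one_sub_exp_neg_pos ht) (by linarith [Real.exp_pos (-t)])
  -- Here `t₂ → ∞` pushes the outer arc to radius 1; afterwards `t₁ → 0` shrinks the inner arc to a
  -- point.
  have hstep : ∀ t₁ : ℝ, 0 < t₁ → arcIntegral α β 0 =
      arcIntegral α β (Real.log (1 - Real.exp (-t₁))) + 2 * Complex.sin (Real.pi * α) *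
        ∫ t in Set.Ioi t₁, (t : ℂ) ^ (α + 1 - 1) • hurwitzKernel (β + 1) t := by
    intro t₁ ht₁
    have hl := (tendsto_arcIntegral_zero hα.le hβ).comp tendsto_log_one_sub_exp_neg_atTop
    have hr := ((intervalIntegral_tendsto_integral_Ioi t₁
      (hM.mono_set (Set.Ioi_subset_Ioi ht₁.le)) tendsto_id).const_mul
        (2 * Complex.sin (Real.pi * α))).const_add
          (arcIntegral α β (Real.log (1 - Real.exp (-t₁))))
    refine tendsto_nhds_unique hl (hr.congr' ?_)
    filter_upwards [eventually_gt_atTop 0] with t₂ ht₂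
    simp only [Function.comp, id]
    rw [arcIntegral_eq_add α β (hneg t₁ ht₁) (hneg t₂ ht₂), integral_edgeIntegrand α β ht₁ ht₂]
  have hlim : Tendsto (fun t₁ : ℝ =>
      ∫ t in Set.Ioi t₁, (t : ℂ) ^ (α + 1 - 1) • hurwitzKernel (β + 1) t) (𝓝[>] 0)
      (𝓝 (mellin (hurwitzKernel (β + 1)) (α + 1))) := by
    have := (aecover_Ioi_of_Ioi (μ := volume) (l := 𝓝[>] (0 : ℝ)) (a := fun t : ℝ => t)
      (A := 0) (tendsto_id.mono_left nhdsWithin_le_nhds)).integral_tendsto_of_countably_generated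
        hM
    refine this.congr' ?_
    filter_upwards [self_mem_nhdsWithin] with t ht
    rw [Measure.restrict_restrict measurableSet_Ioi,
      Set.inter_eq_left.mpr (Set.Ioi_subset_Ioi (Set.mem_Ioi.mp ht).le)]
  have h0 := (tendsto_arcIntegral_atBot hα hβ).comp tendsto_log_one_sub_exp_neg_zero
  have hconst : Tendsto (fun _ : ℝ => arcIntegral α β 0) (𝓝[>] (0 : ℝ))
      (𝓝 (0 + 2 * Complex.sin (Real.pi * α) * mellin (hurwitzKernel (β + 1)) (α + 1))) := by
    refine (h0.add (hlim.const_mul (2 * Complex.sin (Real.pi * α)))).congr' ?_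
    filter_upwards [self_mem_nhdsWithin] with t ht
    exact (hstep t ht).symm
  have h := tendsto_nhds_unique tendsto_const_nhds hconst
  rw [arcIntegral_zero] at h
  linear_combination h / 2

/-- As `sin 0 = 0`, the arc integral does not depend on the radius, and it tends to `2π` for small
radii. -/
theorem integral_hurwitzIntegrand_zero {β : ℂ} (hβ : -1 < β.re) :
    ∫ x in (-(Real.pi / 2))..(Real.pi / 2), hurwitzIntegrand 0 β x = Real.pi := by
  have hconst : ∀ ρ₁ < 0, ∀ ρ₂ < 0, arcIntegral 0 β ρ₂ = arcIntegral 0 β ρ₁ := by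
    intro ρ₁ h₁ ρ₂ h₂
    simp [arcIntegral_eq_add 0 β h₁ h₂]
  have h1 : ∀ ρ < 0, arcIntegral 0 β ρ = 2 * Real.pi := fun ρ hρ => by
    refine tendsto_nhds_unique (tendsto_const_nhds (f := atBot) (α := ℝ))
      ((tendsto_arcIntegral_zero_atBot hβ).congr' ?_)
    filter_upwards [eventually_lt_atBot 0] with ρ' hρ'
    exact hconst ρ hρ ρ' hρ'
  have h2 : arcIntegral 0 β 0 = 2 * Real.pi := by
    refine tendsto_nhds_unique (tendsto_arcIntegral_zero (α := 0) (by simp) hβ)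
      (tendsto_const_nhds.congr' ?_)
    filter_upwards [self_mem_nhdsWithin] with ρ hρ
    exact (h1 ρ hρ).symm
  rw [arcIntegral_zero] at h2
  linear_combination h2 / 2

/-! ### Analytic continuation by the integral itself. -/

/-- The Hurwitz zeta function `s ↦ ζ(s, a)` for `0 < re a`. -/
noncomputable def hurwitzContinuation (a s : ℂ) : ℂ :=
  if 1 < s.re then mellin (hurwitzKernel a) s / Complex.Gamma s
  else -(Complex.Gamma (1 - s) / Real.pi) *
    ∫ x in (-(Real.pi / 2))..(Real.pi / 2), hurwitzIntegrand (s - 1) (a - 1) x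

/-- On the overlap `1 < Re s < 2` the two formulas agree by the reflection formula; no pole of `Γ(1
- s)` lies there. -/
theorem hurwitzContinuation_of_re_lt_two {a s : ℂ} (ha : 0 < a.re) (hs : s.re < 2) :
    hurwitzContinuation a s = -(Complex.Gamma (1 - s) / Real.pi) *
      ∫ x in (-(Real.pi / 2))..(Real.pi / 2), hurwitzIntegrand (s - 1) (a - 1) x := by
  rw [hurwitzContinuation]
  split_ifs with h
  · have hG : Complex.Gamma s ≠ 0 := Complex.Gamma_ne_zero_of_re_pos (by linarith)
    have hG' : Complex.Gamma (1 - s) ≠ 0 := by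
      refine Complex.Gamma_ne_zero fun m hm => ?_
      have hre := congrArg Complex.re hm
      simp only [Complex.sub_re, Complex.one_re, Complex.neg_re, Complex.natCast_re] at hre
      have h1 : (0 : ℝ) < m := by linarith
      have h2 : (m : ℝ) < 1 := by linarith
      have h1' : 0 < m := by exact_mod_cast h1
      have h2' : m < 1 := by exact_mod_cast h2
      omega
    have hpi : (Real.pi : ℂ) ≠ 0 := by exact_mod_cast Real.pi_ne_zero
    have href := Complex.Gamma_mul_Gamma_one_sub s
    have hsin : Complex.sin (Real.pi * s) ≠ 0 := by
      intro h0
      rw [h0, div_zero] at href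
      exact mul_ne_zero hG hG' href
    rw [integral_hurwitzIntegrand_eq_mellin
      (by simp only [Complex.sub_re, Complex.one_re]; linarith)
      (by simp only [Complex.sub_re, Complex.one_re]; linarith), sub_add_cancel, sub_add_cancel,
      mul_sub, mul_one, Complex.sin_sub_pi]
    rw [eq_div_iff hsin, mul_comm (Real.pi : ℂ) s] at href
    rw [div_eq_iff hG]
    field_simp
    linear_combination -mellin (hurwitzKernel a) s * href
  · rfl

/-- For `Re s ≤ 1` the integral is holomorphic in `s` and `Γ(1 - s)` has its only pole at `s = 1`.
-/
theorem isHurwitzZeta_hurwitzContinuation {a : ℂ} (ha : 0 < a.re) :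
    IsHurwitzZeta a (hurwitzContinuation a) := by
  refine ⟨fun s hs => DifferentiableAt.differentiableWithinAt ?_, fun s hs => ?_⟩
  · have hs : s ≠ 1 := hs
    rcases lt_or_ge 1 s.re with h | h
    · have hd : DifferentiableAt ℂ
          (fun s => mellin (hurwitzKernel a) s / Complex.Gamma s) s := by
        refine (differentiableAt_mellin_hurwitzKernel ha h).div
          (Complex.differentiableAt_Gamma s fun m hm => ?_)
          (Complex.Gamma_ne_zero_of_re_pos (by linarith))
        rw [hm] at h
        simp only [Complex.neg_re, Complex.natCast_re] at h
        linarith [(Nat.cast_nonneg m : (0 : ℝ) ≤ m)]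
      refine hd.congr_of_eventuallyEq ?_
      filter_upwards [(isOpen_lt continuous_const Complex.continuous_re).mem_nhds h] with z hz
      exact if_pos hz
    · have hG : DifferentiableAt ℂ (fun s => Complex.Gamma (1 - s)) s := by
        refine DifferentiableAt.comp (f := fun s : ℂ => 1 - s) s
          (Complex.differentiableAt_Gamma _ fun m hm => ?_) (by fun_prop)
        have hre := congrArg Complex.re hm
        simp only [Complex.sub_re, Complex.one_re, Complex.neg_re, Complex.natCast_re] at hre
        have hm0 : (m : ℝ) = 0 := le_antisymm (by linarith) (Nat.cast_nonneg m)
        have hm0' : m = 0 := by exact_mod_cast hm0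
        rw [hm0'] at hm
        apply hs
        linear_combination -hm - (Nat.cast_zero : ((0 : ℕ) : ℂ) = 0)
      have hI := (differentiable_integral_hurwitzIntegrand (β := a - 1)
        (by simp only [Complex.sub_re, Complex.one_re]; linarith)).comp
          (differentiable_id.sub_const (1 : ℂ))
      refine (((hG.div_const (Real.pi : ℂ)).neg).mul (hI s)).congr_of_eventuallyEq ?_
      have h2 : s.re < 2 := by linarith
      filter_upwards [(isOpen_lt Complex.continuous_re continuous_const).mem_nhds h2] with z hz
      exact hurwitzContinuation_of_re_lt_two ha hz
  · rw [hurwitzContinuation, if_pos hs]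
    exact hasSum_cpow_mellin_hurwitzKernel ha hs

/-! ### Shift relations and the formula for `Re β ≥ -1`. -/

theorem IsHurwitzZeta.cpow_neg_add {a : ℂ} (ha : a ≠ 0) {Z : ℂ → ℂ} (hZ : IsHurwitzZeta (a + 1) Z) :
    IsHurwitzZeta a (fun s => a ^ (-s) + Z s) := by
  refine ⟨DifferentiableOn.add ?_ hZ.1, fun s hs => ?_⟩
  · intro s _
    exact (DifferentiableAt.const_cpow (by fun_prop) (Or.inl ha)).differentiableWithinAt
  · have e : ∀ n : ℕ, (n : ℂ) + (a + 1) = ((n + 1 : ℕ) : ℂ) + a := fun n => by push_cast; ring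
    have hsum := hZ.2 s hs
    simp only [e] at hsum
    have h := (hasSum_nat_add_iff (f := fun n : ℕ => 1 / ((n : ℂ) + a) ^ s) 1).mp hsum
    simpa [Complex.cpow_neg, add_comm] using h

theorem IsHurwitzZeta.zero_of_one {Z : ℂ → ℂ} (hZ : IsHurwitzZeta 1 Z) : IsHurwitzZeta 0 Z := by
  refine ⟨hZ.1, fun s hs => ?_⟩
  have hs0 : s ≠ 0 := by
    rintro rfl
    simp at hs
    linarith
  have e : ∀ n : ℕ, (n : ℂ) + 1 = ((n + 1 : ℕ) : ℂ) + 0 := fun n => by push_cast; ring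
  have hsum := hZ.2 s hs
  simp only [e] at hsum
  have h := (hasSum_nat_add_iff (f := fun n : ℕ => 1 / ((n : ℂ) + 0) ^ s) 1).mp hsum
  simpa [hs0] using h

theorem isHurwitzZeta_riemannZeta : IsHurwitzZeta 1 riemannZeta := by
  refine ⟨fun s hs => (differentiableAt_riemannZeta hs).differentiableWithinAt, fun s hs => ?_⟩
  rw [zeta_eq_tsum_one_div_nat_add_one_cpow hs]
  refine Summable.hasSum ?_
  have h := (summable_nat_add_iff 1).mpr (Complex.summable_one_div_nat_cpow.mpr hs)
  simpa using h

theorem integral_hurwitzIntegrand_of_re_gt {α β : ℂ} (hβ : -1 < β.re) (hα : α ≠ 0) :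
    ∫ x in (-(Real.pi / 2))..(Real.pi / 2), hurwitzIntegrand α β x =
      -((Real.pi : ℂ) / Complex.Gamma (-α)) * hurwitzZetaC (α + 1) (β + 1) := by
  have ha : 0 < (β + 1).re := by simp only [Complex.add_re, Complex.one_re]; linarith
  have hpi : (Real.pi : ℂ) ≠ 0 := by exact_mod_cast Real.pi_ne_zero
  rw [(isHurwitzZeta_hurwitzContinuation ha).hurwitzZetaC_eq (by simpa using hα)]
  rcases lt_or_ge 0 α.re with h | h
  · have h1 : 1 < (α + 1).re := by simp only [Complex.add_re, Complex.one_re]; linarith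
    have hG : Complex.Gamma (α + 1) ≠ 0 := Complex.Gamma_ne_zero_of_re_pos (by linarith)
    rw [hurwitzContinuation, if_pos h1, integral_hurwitzIntegrand_eq_mellin h hβ]
    -- Positive integers `α` are included: there `Γ(-α)` is 0 by default, so `π / Γ(-α) = 0`,
    -- matching `sin(πα) = 0`.
    have href := Complex.Gamma_mul_Gamma_one_sub (-α)
    rw [sub_neg_eq_add, add_comm 1 α, mul_neg, Complex.sin_neg, ← eq_div_iff hG] at href
    have : (Real.pi : ℂ) / Complex.Gamma (-α) =
        -(Complex.sin (Real.pi * α) * Complex.Gamma (α + 1)) := by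
      rw [href, div_div, div_div_eq_mul_div, mul_div_cancel_left₀ _ hpi]
      ring
    rw [this]
    field_simp
  · have hG : Complex.Gamma (-α) ≠ 0 := by
      refine Complex.Gamma_ne_zero fun m hm => ?_
      have hre := congrArg Complex.re hm
      simp only [Complex.neg_re, Complex.natCast_re] at hre
      have hm0 : (m : ℝ) = 0 := le_antisymm (by linarith) (Nat.cast_nonneg m)
      have hm0' : m = 0 := by exact_mod_cast hm0
      rw [hm0'] at hm
      exact hα (by simpa using hm)
    rw [hurwitzContinuation_of_re_lt_two ha
      (by simp only [Complex.add_re, Complex.one_re]; linarith), add_sub_cancel_right,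
      add_sub_cancel_right, show 1 - (α + 1) = -α by ring]
    field_simp

theorem hurwitzZetaC_eq_cpow_add {a s : ℂ} (ha : 0 ≤ a.re) (ha0 : a ≠ 0) (hs : s ≠ 1) :
    hurwitzZetaC s a = a ^ (-s) + hurwitzZetaC s (a + 1) := by
  have h1 := isHurwitzZeta_hurwitzContinuation (a := a + 1)
    (by simp only [Complex.add_re, Complex.one_re]; linarith)
  rw [(h1.cpow_neg_add ha0).hurwitzZetaC_eq hs, h1.hurwitzZetaC_eq hs]

theorem hurwitzZetaC_zero {s : ℂ} (hs : s ≠ 1) : hurwitzZetaC s 0 = hurwitzZetaC s 1 := by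
  rw [isHurwitzZeta_riemannZeta.zero_of_one.hurwitzZetaC_eq hs,
    isHurwitzZeta_riemannZeta.hurwitzZetaC_eq hs]

/-- After the shift, `ζ(α+1, β+ε+2)` is again an integral, with parameter `β + 1 + ε`, so its limit
needs no separate continuity of zeta in the second argument. -/
theorem integral_hurwitzIntegrand_of_re_eq {α β : ℂ} (hβ : β.re = -1) (hα : α.re < -1) :
    ∫ x in (-(Real.pi / 2))..(Real.pi / 2), hurwitzIntegrand α β x =
      -((Real.pi : ℂ) / Complex.Gamma (-α)) * hurwitzZetaC (α + 1) (β + 1) := by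
  have hα0 : α ≠ 0 := by
    rintro rfl
    simp at hα
    linarith
  have hs : α + 1 ≠ 1 := by simpa using hα0
  have ha0 : (β + 1).re = 0 := by simp [hβ]
  have hs0 : 0 < (-(α + 1)).re := by
    simp only [Complex.neg_re, Complex.add_re, Complex.one_re]; linarith
  have hs0' : -(α + 1) ≠ 0 := by
    intro h
    rw [h] at hs0
    simp at hs0
  have hsplit : hurwitzZetaC (α + 1) (β + 1) =
      (β + 1) ^ (-(α + 1)) + hurwitzZetaC (α + 1) (β + 1 + 1) := by
    by_cases h : β + 1 = 0
    -- The omitted term for `a = 0` matches `0 ^ (-(α + 1)) = 0`.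
    · rw [h, hurwitzZetaC_zero hs, Complex.zero_cpow hs0', zero_add, zero_add]
    · exact hurwitzZetaC_eq_cpow_add ha0.ge h hs
  have hshift : ∀ ε : ℝ, 0 ≤ ε →
      -((Real.pi : ℂ) / Complex.Gamma (-α)) * hurwitzZetaC (α + 1) (β + ε + 1 + 1) =
        ∫ x in (-(Real.pi / 2))..(Real.pi / 2), hurwitzIntegrand α (β + 1 + ε) x := by
    intro ε hε
    rw [integral_hurwitzIntegrand_of_re_gt _ hα0]
    · ring_nf
    · simp only [Complex.add_re, Complex.one_re, Complex.ofReal_re]; linarith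
  have hcpow : Tendsto (fun ε : ℝ => (β + ε + 1) ^ (-(α + 1))) (𝓝[>] 0)
      (𝓝 ((β + 1) ^ (-(α + 1)))) := by
    have hc : ContinuousAt (fun ε : ℝ => (β + ε + 1) ^ (-(α + 1))) 0 := by
      by_cases h : β + 1 = 0
      · have h' : ∀ ε : ℝ, β + ε + 1 = ε := fun ε => by linear_combination h
        simp_rw [h']
        exact Complex.continuousAt_ofReal_cpow_const 0 _ (Or.inl hs0)
      · refine ContinuousAt.cpow (by fun_prop) continuousAt_const ?_
        refine Complex.mem_slitPlane_iff.mpr (Or.inr fun him => h ?_)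
        refine Complex.ext ha0 ?_
        simpa using him
    simpa using hc.tendsto.mono_left nhdsWithin_le_nhds
  have hI := tendsto_integral_hurwitzIntegrand_add (α := α) (β := β) (Or.inr ⟨hβ, hα⟩)
  have hI1 := tendsto_integral_hurwitzIntegrand_add (α := α) (β := β + 1)
    (Or.inl (by rw [ha0]; norm_num))
  have hlim := (hcpow.const_mul (-((Real.pi : ℂ) / Complex.Gamma (-α)))).add hI1
  refine (tendsto_nhds_unique hI (hlim.congr' ?_)).trans ?_
  · filter_upwards [self_mem_nhdsWithin] with ε hε
    have hε : 0 < ε := hε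
    have hpos : 0 < (β + ε + 1).re := by
      simp only [Complex.add_re, Complex.one_re, Complex.ofReal_re, hβ]; linarith
    have hne : β + ε + 1 ≠ 0 := by
      intro h
      rw [h] at hpos
      simp at hpos
    rw [integral_hurwitzIntegrand_of_re_gt (α := α) (β := β + ε)
      (by simp only [Complex.add_re, Complex.ofReal_re, hβ]; linarith) hα0,
      hurwitzZetaC_eq_cpow_add hpos.le hne hs, mul_add, hshift ε hε.le]
  · have h0 := hshift 0 le_rfl
    simp only [Complex.ofReal_zero, add_zero] at h0
    rw [hsplit, mul_add, h0]

/-! ### The limit at `α = 0` and the specialization `β = 0`. -/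

/-- Continuity of the integral at `α = 0` gives the limit, without computing the residue of zeta. -/
theorem tendsto_mul_hurwitzZetaC_zero {β : ℂ} (hβ : -1 < β.re) :
    Tendsto (fun z : ℂ => -((Real.pi : ℂ) / Complex.Gamma (-z)) * hurwitzZetaC (z + 1) (β + 1))
      (𝓝[≠] 0) (𝓝 (Real.pi : ℂ)) := by
  have hc := (differentiable_integral_hurwitzIntegrand hβ).continuous.tendsto 0
  rw [integral_hurwitzIntegrand_zero hβ] at hc
  refine (hc.mono_left nhdsWithin_le_nhds).congr' ?_
  filter_upwards [self_mem_nhdsWithin] with z hz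
  exact integral_hurwitzIntegrand_of_re_gt hβ hz

theorem hurwitzIntegrand_zero_right (α : ℂ) :
    hurwitzIntegrand α 0 =
      fun x : ℝ => (Complex.log (1 + Complex.exp (-2 * Complex.I * x))) ^ α := by
  ext x
  simp [hurwitzIntegrand]

theorem neg_pi_mul_riemannZeta_div_Gamma {α : ℂ} (hα : α ≠ 1) :
    -((Real.pi : ℂ) * riemannZeta α / Complex.Gamma (1 - α)) =
      -((Real.pi : ℂ) / Complex.Gamma (-(α - 1))) * hurwitzZetaC (α - 1 + 1) (0 + 1) := by
  rw [sub_add_cancel, zero_add, isHurwitzZeta_riemannZeta.hurwitzZetaC_eq hα, neg_sub]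
  ring

theorem mainTheorem2 :
    (∀ α β : ℂ, (-1 < β.re ∨ (β.re = -1 ∧ α.re < -1)) →
      IntervalIntegrable (hurwitzIntegrand α β) MeasureTheory.volume
        (-(Real.pi / 2)) (Real.pi / 2) ∧
      (α ≠ 0 →
        ∫ x in (-(Real.pi / 2))..(Real.pi / 2), hurwitzIntegrand α β x =
          -((Real.pi : ℂ) / Complex.Gamma (-α)) * hurwitzZetaC (α + 1) (β + 1)) ∧
      (α = 0 →
        ∫ x in (-(Real.pi / 2))..(Real.pi / 2), hurwitzIntegrand α β x = (Real.pi : ℂ) ∧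
        Filter.Tendsto
          (fun z : ℂ => -((Real.pi : ℂ) / Complex.Gamma (-z)) * hurwitzZetaC (z + 1) (β + 1))
          (nhdsWithin 0 {0}ᶜ) (nhds (Real.pi : ℂ)))) ∧
    (∀ α : ℂ,
      IntervalIntegrable
        (fun x : ℝ => (Complex.log (1 + Complex.exp (-2 * Complex.I * x))) ^ (α - 1))
        MeasureTheory.volume (-(Real.pi / 2)) (Real.pi / 2) ∧
      (α ≠ 1 →
        ∫ x in (-(Real.pi / 2))..(Real.pi / 2),
            (Complex.log (1 + Complex.exp (-2 * Complex.I * x))) ^ (α - 1) =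
          -((Real.pi : ℂ) * riemannZeta α / Complex.Gamma (1 - α))) ∧
      (α = 1 →
        ∫ x in (-(Real.pi / 2))..(Real.pi / 2),
            (Complex.log (1 + Complex.exp (-2 * Complex.I * x))) ^ (α - 1) = (Real.pi : ℂ) ∧
        Filter.Tendsto
          (fun z : ℂ => -((Real.pi : ℂ) * riemannZeta z / Complex.Gamma (1 - z)))
          (nhdsWithin 1 {1}ᶜ) (nhds (Real.pi : ℂ)))) := by
  have h0 : -1 < (0 : ℂ).re := by simp
  refine ⟨fun α β h => ⟨intervalIntegrable_hurwitzIntegrand h, fun hα => ?_, ?_⟩,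
    fun α => ?_⟩
  · rcases h with h | ⟨hβ, hα'⟩
    · exact integral_hurwitzIntegrand_of_re_gt h hα
    · exact integral_hurwitzIntegrand_of_re_eq hβ hα'
  · rintro rfl
    have hβ : -1 < β.re := h.resolve_right fun h' => by
      have := h'.2
      simp at this
      linarith
    exact ⟨integral_hurwitzIntegrand_zero hβ, tendsto_mul_hurwitzZetaC_zero hβ⟩
  · rw [← hurwitzIntegrand_zero_right]
    refine ⟨intervalIntegrable_hurwitzIntegrand (Or.inl h0), fun hα => ?_, ?_⟩
    · rw [neg_pi_mul_riemannZeta_div_Gamma hα]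
      exact integral_hurwitzIntegrand_of_re_gt h0 (sub_ne_zero.mpr hα)
    · rintro rfl
      rw [sub_self]
      refine ⟨integral_hurwitzIntegrand_zero h0, ?_⟩
      have ht : Filter.Tendsto (fun z : ℂ => z - 1) (nhdsWithin 1 {1}ᶜ) (nhdsWithin 0 {0}ᶜ) := by
        refine tendsto_nhdsWithin_iff.mpr ⟨?_, ?_⟩
        · have hc : Continuous fun z : ℂ => z - 1 := by fun_prop
          exact (hc.tendsto' 1 0 (by simp)).mono_left nhdsWithin_le_nhds
        · filter_upwards [self_mem_nhdsWithin] with z hz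
          exact sub_ne_zero.mpr hz
      refine ((tendsto_mul_hurwitzZetaC_zero h0).comp ht).congr' ?_
      filter_upwards [self_mem_nhdsWithin] with z hz
      exact (neg_pi_mul_riemannZeta_div_Gamma hz).symm
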